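/- Write $\mathcal N_\rho$ ($\rho\in[0,1]$) for the binary symmetric channel that flips each bit independently with probability $(1-\rho)/2$, and call a function $\nu$ of the security parameter $\lambda$ negligible if $\lambda^{c}\,\nu(\lambda)\to 0$ for every $c\in\mathbb N$. A *crypto oracle* is a function $\mathcal B^{\mathcal R}:\{0,1\}^*\to\{0,1\}^*$, where $\mathcal B$ is a stateless deterministic polynomial-time Turing machine with oracle access to a secret uniformly random function $\mathcal R:\{0,1\}^*\to\{0,1\}$. A *private-key code relative to $\mathcal B^{\mathcal R}$* consists of probabilistic polynomial-time algorithms with oracle access to $\mathcal B^{\mathcal R}$: $\mathsf{KeyGen}(1^\lambda)$ outputs a key $\mathsf{sk}\in\{0,1\}^{\ell(\lambda)}$; $\mathsf{Enc}(1^\lambda,\mathsf{sk},m)$ maps a message $m\in\{0,1\}^{k(\lambda)}$ to a codeword in $\{0,1\}^{n(\lambda)}$; and $\mathsf{Dec}(1^\lambda,\mathsf{sk},c)$ maps $c\in\{0,1\}^{n(\lambda)}$ to an element of $\{0,1\}^{k(\lambda)}\cup\{\bot\}$. Here $k\ge 0$ is polynomially bounded ($k=0$ is the zero-bit case). All probabilities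 below are over $\mathcal R$ as well as all other randomness. * The code is *$\delta$-complete* for $\mathcal N_{\rho}$ if for all $\lambda$ and all $m\in\{0,1\}^{k(\lambda)}$, $\Pr[\mathsf{Dec}(\mathsf{sk},\mathcal N_{\rho(\lambda)}(\mathsf{Enc}(\mathsf{sk},m)))=m]\ge 1-\delta(\lambda)$. * It is *$\mu$-sound* if for all $\lambda$ and every fixed $c\in\{0,1\}^{n(\lambda)}$, $\Pr[\mathsf{Dec}(\mathsf{sk},c)=\bot]\ge 1-\mu(\lambda)$. * It is *statistically pseudorandom* if every computationally unbounded adversary that makes polynomially many queries, of polynomial total length, to $\mathcal B^{\mathcal R}$ and to an encoding oracle has negligible advantage in distinguishing the encoding oracle $\mathsf{Enc}(\mathsf{sk},\cdot)$ (fresh randomness in each call) from an oracle that answers each query with a fresh uniformly random string in $\{0,1\}^{n(\lambda)}$. **Statement.** Let $\mathcal B^{\mathcal R}$ be any crypto oracle and let $\rho:\mathbb N\to[0,1]$ satisfy $\rho=1-\Omega(1)$, i.e. there is a constant $c>0$ with $\rho(\lambda)\le 1-c$ for all sufficiently large $\lambda$. Then: 1. relative to $\mathcal B^{\mathcal R}$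 there is no statistically secure pseudorandom code for $\mathcal N_\rho$, i.e. no code that is statistically pseudorandom, $\delta$-complete for $\mathcal N_\rho$ and $\mu$-sound with negligible $\delta$ and $\mu$; 2. moreover, every private-key code relative to $\mathcal B^{\mathcal R}$ that is statistically pseudorandom, $\delta$-complete for $\mathcal N_\rho$ and $\mu$-sound (for arbitrary $\delta,\mu:\mathbb N\to\mathbb R$) has a negligible completeness–soundness gap: there is a negligible function $\nu$ with $\delta(\lambda)+\mu(\lambda)\ge 1-\nu(\lambda)$ for all $\lambda$. -/

import Mathlib

open MeasureTheory Filter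

/-! ### Probabilistic multi-tape Turing machines with an oracle -/

/-- The tapes of a machine with `a` input tapes and `w` work tapes.  Queries are written on `query`,
oracle answers appear on `answer`, and the result is written on `output`. -/
inductive TapeName (a w : ℕ) where
  | input (i : Fin a)
  | work (i : Fin w)
  | query
  | answer
  | output

inductive HeadMove where
  | left
  | stay
  | right

/-- A two-way infinite tape over the alphabet `{0, 1, blank}` (`none` is the blank):
the cells left of the head (nearest first), the scanned cell, the cells right of the head.
All cells that are not listed are blank. -/
structure BitTape where
  left : List (Option Bool)
  head : Option Bool
  right : List (Option Bool)

namespace BitTape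

def blank : BitTape := ⟨[], none, []⟩

/-- The tape that holds the string `x`, with the head on its first symbol. -/
def ofString (x : List Bool) : BitTape :=
  match x with
  | [] => blank
  | b :: l => ⟨[], some b, l.map some⟩

/-- Write a symbol in the scanned cell, then move the head. -/
def update (t : BitTape) (s : Option Bool) : HeadMove → BitTape
  | .left => ⟨t.left.tail, t.left.headD none, s :: t.right⟩
  | .stay => ⟨t.left, s, t.right⟩
  | .right => ⟨s :: t.left, t.right.headD none, t.right.tail⟩

/-- The maximal blank-free string at the beginning of a list of cells. -/
def bitsOf : List (Option Bool) → List Bool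
  | some b :: l => b :: bitsOf l
  | _ => []

/-- The string held by the tape: from the scanned cell rightwards, up to the first blank. -/
def contents (t : BitTape) : List Bool := bitsOf (t.head :: t.right)

end BitTape

/-- What a machine does in one step: halt; ask the oracle; or write on every tape and move every
head.  In the last two cases it also enters a new state. -/
inductive MachineAction (State : Type) (a w : ℕ) where
  | halt
  | ask (next : State)
  | act (next : State) (write : TapeName a w → Option Bool × HeadMove)

/-- A (probabilistic) oracle Turing machine with `a` input tapes.  The transition function sees the
state, the scanned symbols, and one fresh random bit per step. -/
structure OracleTM (a : ℕ) where
  workTapes : ℕ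
  State : Type
  finiteState : Finite State
  start : State
  trans : State → (TapeName a workTapes → Option Bool) → Bool → MachineAction State a workTapes

namespace OracleTM

variable {a : ℕ}

/-- The machine does not use its random bits. -/
def IsDeterministic (M : OracleTM a) : Prop :=
  ∀ s σ, M.trans s σ true = M.trans s σ false

/-- A configuration; the state `none` means that the machine has halted. -/
structure Cfg (M : OracleTM a) where
  state : Option M.State
  tape : TapeName a M.workTapes → BitTape

def initial (M : OracleTM a) (x : Fin a → List Bool) : Cfg M where
  state := some M.start
  tape
    | .input i => BitTape.ofString (x i)
    | _ => BitTape.blank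

/-- One step with oracle `O` and random bit `coin`.  An oracle call takes one step: it reads the
query tape, erases it, and puts the answer on the answer tape. -/
def step (M : OracleTM a) (O : List Bool → List Bool) (coin : Bool) (c : Cfg M) : Cfg M :=
  match c.state with
  | none => c
  | some s =>
    match M.trans s (fun i => (c.tape i).head) coin with
    | .halt => ⟨none, c.tape⟩
    | .ask s' =>
      ⟨some s', fun
        | .query => BitTape.blank
        | .answer => BitTape.ofString (O (c.tape .query).contents)
        | i => c.tape i⟩
    | .act s' wr => ⟨some s', fun i => (c.tape i).update (wr i).1 (wr i).2⟩

/-- The configuration reached on input `x` after one step for each of the random bits `r`. -/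
def exec (M : OracleTM a) (O : List Bool → List Bool) (x : Fin a → List Bool) (r : List Bool) :
    Cfg M :=
  r.foldl (fun c coin => M.step O coin c) (M.initial x)

def result (M : OracleTM a) (O : List Bool → List Bool) (x : Fin a → List Bool) (r : List Bool) :
    List Bool :=
  ((M.exec O x r).tape .output).contents

end OracleTM

/-- A probabilistic polynomial-time oracle machine, relative to the oracles in `𝒪`: with each of
these oracles, on all inputs and for all random bits, it halts within a number of steps that is
polynomial in the total input length. -/
structure PPTMachine (a : ℕ) (𝒪 : Set (List Bool → List Bool)) where
  machine : OracleTM a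
  time : Polynomial ℕ
  halts : ∀ O ∈ 𝒪, ∀ (x : Fin a → List Bool) (r : List Bool),
    r.length = time.eval (∑ i, (x i).length) → (machine.exec O x r).state = none

/-- The distribution of the output on input `x` with oracle `O`, over uniform random bits. -/
noncomputable def PPTMachine.dist {a : ℕ} {𝒪 : Set (List Bool → List Bool)} (M : PPTMachine a 𝒪)
    (O : List Bool → List Bool) (x : Fin a → List Bool) : PMF (List Bool) :=
  (PMF.uniformOfFintype (List.Vector Bool (M.time.eval (∑ i, (x i).length)))).map
    fun r => M.machine.result O x r.toList

/-! ### Crypto oracles -/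

/-- A function `R : {0,1}* → {0,1}`, as an oracle whose answers are one bit long. -/
def bitOracle (R : List Bool → Bool) : List Bool → List Bool := fun q => [R q]

/-- A crypto oracle: a deterministic polynomial-time machine with oracle access to a function
`R : {0,1}* → {0,1}`.  It is stateless: each query to it is answered by a fresh run. -/
structure CryptoOracle where
  alg : PPTMachine 1 (Set.range bitOracle)
  deterministic : alg.machine.IsDeterministic

/-- The function `{0,1}* → {0,1}*` computed by the crypto oracle when its secret function is `R`. -/
def CryptoOracle.fn (B : CryptoOracle) (R : List Bool → Bool) (q : List Bool) : List Bool :=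
  B.alg.machine.result (bitOracle R) ![q] (List.replicate (B.alg.time.eval q.length) false)

/-- The uniformly random function `{0,1}* → {0,1}`. -/
noncomputable def randomFunction : Measure (List Bool → Bool) :=
  Measure.infinitePi fun _ => (PMF.uniformOfFintype Bool).toMeasure

/-- The probability of the event `S` in an experiment that depends on a random function. -/
noncomputable def prob {α : Type} (game : (List Bool → Bool) → PMF α) (S : Set α) : ℝ :=
  (∫⁻ R, (game R).toOuterMeasure S ∂randomFunction).toReal

/-! ### The binary symmetric channel -/

/-- The Bernoulli distribution with parameter `(1 - ρ) / 2`. -/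
noncomputable def flipBit (ρ : unitInterval) : PMF Bool :=
  PMF.ofFintype (fun b => ENNReal.ofReal (if b then (1 - ρ) / 2 else (1 + ρ) / 2)) (by
    have h0 := ρ.2.1
    have h1 := ρ.2.2
    rw [Fintype.sum_bool, ← ENNReal.ofReal_add (by simp; linarith) (by simp; linarith),
      ← ENNReal.ofReal_one]
    congr 1
    simp
    ring)

/-- The channel that flips each bit independently with probability `(1 - ρ) / 2`. -/
noncomputable def noise (ρ : unitInterval) : List Bool → PMF (List Bool)
  | [] => PMF.pure []
  | b :: x => do
    let e ← flipBit ρ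
    let y ← noise ρ x
    return (xor b e) :: y

/-! ### Private-key codes relative to a crypto oracle -/

/-- The security parameter in unary. -/
def unary (κ : ℕ) : List Bool := List.replicate κ true

/-- How the decoder's output string is read: `1m` is the message `m`; anything else is `⊥`. -/
def readMessage : List Bool → Option (List Bool)
  | true :: m => some m
  | _ => none

/-- The oracles `B^R`. -/
def CryptoOracle.oracles (B : CryptoOracle) : Set (List Bool → List Bool) := Set.range B.fn

/-- The algorithms of a binary private-key code relative to the crypto oracle `B`. -/
structure OracleCode (B : CryptoOracle) where
  keyLen : ℕ → ℕ
  msgLen : ℕ → ℕ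
  codeLen : ℕ → ℕ
  msgLen_poly : ∃ p : Polynomial ℕ, ∀ κ, msgLen κ ≤ p.eval κ
  keyGen : PPTMachine 1 B.oracles
  enc : PPTMachine 3 B.oracles
  dec : PPTMachine 3 B.oracles
  keyGen_length : ∀ O ∈ B.oracles, ∀ κ, ∀ sk ∈ (keyGen.dist O ![unary κ]).support,
    sk.length = keyLen κ
  enc_length : ∀ O ∈ B.oracles, ∀ κ (sk m : List Bool), sk.length = keyLen κ →
    m.length = msgLen κ → ∀ c ∈ (enc.dist O ![unary κ, sk, m]).support, c.length = codeLen κ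
  dec_length : ∀ O ∈ B.oracles, ∀ κ (sk c : List Bool), sk.length = keyLen κ →
    c.length = codeLen κ → ∀ y ∈ (dec.dist O ![unary κ, sk, c]).support,
      ∀ m, readMessage y = some m → m.length = msgLen κ

/-- A computationally unbounded (non-uniform, randomized, adaptive) distinguisher for messages of
length `k`, as the tree of its possible interactions with the encoding oracle and with `B^R`. -/
inductive Adversary (k : ℕ) : Type where
  | guess (b : Bool)
  | coin (next : Bool → Adversary k)
  | askEnc (m : List.Vector Bool k) (next : List Bool → Adversary k)
  | askOracle (q : List Bool) (next : List Bool → Adversary k)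

namespace Adversary

variable {k : ℕ}

/-- On every path, the number of oracle calls plus the total length of the queries to `B^R` is at
most `N`. -/
def CostAtMost : Adversary k → ℕ → Prop
  | guess _, _ => True
  | coin next, N => ∀ b, (next b).CostAtMost N
  | askEnc _ next, N => 1 ≤ N ∧ ∀ c, (next c).CostAtMost (N - 1)
  | askOracle q next, N => q.length + 1 ≤ N ∧ ∀ y, (next y).CostAtMost (N - (q.length + 1))

/-- The distribution of the guess, with encoding oracle `E` (fresh randomness in every call) and
oracle `O`. -/
noncomputable def run (E : List Bool → PMF (List Bool)) (O : List Bool → List Bool) :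
    Adversary k → PMF Bool
  | guess b => PMF.pure b
  | coin next => (PMF.uniformOfFintype Bool).bind fun b => (next b).run E O
  | askEnc m next => (E m.toList).bind fun c => (next c).run E O
  | askOracle q next => (next (O q)).run E O

end Adversary

noncomputable def uniformString (n : ℕ) : PMF (List Bool) :=
  (PMF.uniformOfFintype (List.Vector Bool n)).map List.Vector.toList

/-- Negligible functions of the security parameter. -/
def Negligible (f : ℕ → ℝ) : Prop :=
  Asymptotics.SuperpolynomialDecay atTop (fun κ : ℕ => (κ : ℝ)) f

/-- The channels `N_ρ` have a constant noise rate: `ρ = 1 - Ω(1)`. -/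
def ConstantRate (ρ : ℕ → unitInterval) : Prop :=
  ∃ c : ℝ, 0 < c ∧ ∀ᶠ κ in atTop, (ρ κ : ℝ) ≤ 1 - c

namespace OracleCode

variable {B : CryptoOracle} (C : OracleCode B)

noncomputable def sampleKey (R : List Bool → Bool) (κ : ℕ) : PMF (List Bool) :=
  C.keyGen.dist (B.fn R) ![unary κ]

noncomputable def encode (R : List Bool → Bool) (κ : ℕ) (sk m : List Bool) : PMF (List Bool) :=
  C.enc.dist (B.fn R) ![unary κ, sk, m]

/-- The decoder's output, with `none` for `⊥`. -/
noncomputable def decode (R : List Bool → Bool) (κ : ℕ) (sk c : List Bool) :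
    PMF (Option (List Bool)) :=
  (C.dec.dist (B.fn R) ![unary κ, sk, c]).map readMessage

noncomputable def completenessGame (ρ : ℕ → unitInterval) (κ : ℕ) (m : List Bool)
    (R : List Bool → Bool) : PMF (Option (List Bool)) := do
  let sk ← C.sampleKey R κ
  let c ← C.encode R κ sk m
  let c' ← noise (ρ κ) c
  C.decode R κ sk c'

noncomputable def soundnessGame (κ : ℕ) (c : List Bool) (R : List Bool → Bool) :
    PMF (Option (List Bool)) := do
  let sk ← C.sampleKey R κ
  C.decode R κ sk c

noncomputable def realGame (κ : ℕ) (A : Adversary (C.msgLen κ)) (R : List Bool → Bool) :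
    PMF Bool := do
  let sk ← C.sampleKey R κ
  A.run (C.encode R κ sk) (B.fn R)

noncomputable def idealGame (κ : ℕ) (A : Adversary (C.msgLen κ)) (R : List Bool → Bool) :
    PMF Bool :=
  A.run (fun _ => uniformString (C.codeLen κ)) (B.fn R)

/-- `δ`-completeness for the channels `N_ρ`. -/
def Complete (ρ : ℕ → unitInterval) (δ : ℕ → ℝ) : Prop :=
  ∀ (κ : ℕ) (m : List.Vector Bool (C.msgLen κ)),
    1 - δ κ ≤ prob (C.completenessGame ρ κ m.toList) {some m.toList}

/-- `μ`-soundness. -/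
def Sound (μ : ℕ → ℝ) : Prop :=
  ∀ (κ : ℕ) (c : List.Vector Bool (C.codeLen κ)),
    1 - μ κ ≤ prob (C.soundnessGame κ c.toList) {none}

noncomputable def advantage (A : (κ : ℕ) → Adversary (C.msgLen κ)) (κ : ℕ) : ℝ :=
  |prob (C.realGame κ (A κ)) {true} - prob (C.idealGame κ (A κ)) {true}|

/-- Statistical pseudorandomness relative to `B`: every computationally unbounded adversary that
makes polynomially many queries, of polynomial total length, has negligible advantage. -/
def StatPseudorandom : Prop :=
  ∀ A : (κ : ℕ) → Adversary (C.msgLen κ),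
    (∃ p : Polynomial ℕ, ∀ κ, (A κ).CostAtMost (p.eval κ)) → Negligible (C.advantage A)

/-- `C` is a statistically secure pseudorandom code for the channels `N_ρ`. -/
def IsStatPRC (ρ : ℕ → unitInterval) : Prop :=
  C.StatPseudorandom ∧ (∃ δ, Negligible δ ∧ C.Complete ρ δ) ∧ ∃ μ, Negligible μ ∧ C.Sound μ

end OracleCode

/-!
A stopping set of positions of the random function is learned that contains all queries of the key
generation and all heavy positions, i.e. those that the decoder queries on a uniform string with
noticeable probability, given what has been learned.  Score a string `c` by the probability that the
decoder, with the unlearned part of the random function resampled, accepts a noisy version of `c`,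
plus `1 / ε` times the sum over the unlearned positions of the squared probability that it is
queried in this experiment.

On encodings the mean score is, up to `O(q ε)`, at least the completeness.  The encoder determines
only `q` unlearned values, so resampling them instead loses at most the sum of `q` of these query
probabilities, and `t ≤ t ^ 2 / ε + ε` for each of them.  On uniform strings the mean score is, up
to `O(q ε)`, at most the probability of false acceptance: for a light position, small-set expansion
of the noisy cube makes the mean of the squared noisy query probability much smaller than the mean
query probability, and the latter sum up to at most `q`.

An unbounded adversary knows neither the key nor the learned values, but there are only
exponentially many possibilities in total, each with a score of its own.  By Chernoff and union
bounds, polynomially many encodings of one message suffice to tell whether one of these scores is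
larger than it is on uniform strings.
-/

open scoped BigOperators

/-! ### Noise on the Boolean cube -/

section Noise

variable {n : ℕ}

/-- The restriction of `f` to the subcube of the strings that begin with `b`. -/
def slice (b : Bool) (f : List.Vector Bool (n + 1) → ℝ) (v : List.Vector Bool n) : ℝ := f (b ::ᵥ v)

theorem sum_eq_sum_slice (f : List.Vector Bool (n + 1) → ℝ) :
    ∑ v, f v = ∑ b, ∑ v, slice b f v := by
  let e : Bool × List.Vector Bool n ≃ List.Vector Bool (n + 1) :=
    { toFun := fun p => p.1 ::ᵥ p.2
      invFun := fun v => (v.head, v.tail)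
      left_inv := fun p => by simp
      right_inv := fun v => by simp }
  rw [← Fintype.sum_prod_type', ← e.sum_comp]
  rfl

theorem expect_eq_expect_slice (f : List.Vector Bool (n + 1) → ℝ) :
    𝔼 v, f v = (𝔼 v, slice true f v + 𝔼 v, slice false f v) / 2 := by
  simp only [Fintype.expect_eq_sum_div_card, sum_eq_sum_slice, Fintype.sum_bool, card_vector,
    Fintype.card_bool, pow_succ, Nat.cast_mul, Nat.cast_pow, Nat.cast_ofNat]
  field_simp

/-- The probability that the channel with correlation `ρ` turns the bit `a` into `b`. -/
noncomputable def flipWeight (ρ : ℝ) (a b : Bool) : ℝ := if a = b then (1 + ρ) / 2 else (1 - ρ) / 2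

/-- The probability that the channel with correlation `ρ` turns `c` into `y`. -/
noncomputable def noiseWeight (ρ : ℝ) (c y : List.Vector Bool n) : ℝ :=
  ∏ i, flipWeight ρ (c.get i) (y.get i)

theorem flipWeight_nonneg {ρ : ℝ} (h0 : 0 ≤ ρ) (h1 : ρ ≤ 1) (a b : Bool) :
    0 ≤ flipWeight ρ a b := by
  unfold flipWeight
  split_ifs <;> linarith

theorem flipWeight_comm (ρ : ℝ) (a b : Bool) : flipWeight ρ a b = flipWeight ρ b a := by
  simp only [flipWeight, eq_comm]

theorem noiseWeight_nonneg {ρ : ℝ} (h0 : 0 ≤ ρ) (h1 : ρ ≤ 1) (c y : List.Vector Bool n) :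
    0 ≤ noiseWeight ρ c y :=
  Finset.prod_nonneg fun _ _ => flipWeight_nonneg h0 h1 _ _

theorem noiseWeight_comm (ρ : ℝ) (c y : List.Vector Bool n) :
    noiseWeight ρ c y = noiseWeight ρ y c :=
  Finset.prod_congr rfl fun _ _ => flipWeight_comm ρ _ _

theorem noiseWeight_cons (ρ : ℝ) (a b : Bool) (c y : List.Vector Bool n) :
    noiseWeight ρ (a ::ᵥ c) (b ::ᵥ y) = flipWeight ρ a b * noiseWeight ρ c y := by
  simp [noiseWeight, Fin.prod_univ_succ]

/-- The noise operator: `noiseOp ρ f c` is the mean of `f` over the output of the channel with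
correlation `ρ` on input `c`. -/
noncomputable def noiseOp (ρ : ℝ) : (List.Vector Bool n → ℝ) →ₗ[ℝ] List.Vector Bool n → ℝ :=
  Matrix.mulVecLin (Matrix.of (noiseWeight ρ))

theorem noiseOp_apply (ρ : ℝ) (f : List.Vector Bool n → ℝ) (c : List.Vector Bool n) :
    noiseOp ρ f c = ∑ y, noiseWeight ρ c y * f y := rfl

theorem noiseOp_of_length_zero (ρ : ℝ) (f : List.Vector Bool 0 → ℝ) : noiseOp ρ f = f := by
  funext c
  rw [noiseOp_apply, Fintype.sum_subsingleton _ c]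
  simp [noiseWeight]

theorem slice_noiseOp (ρ : ℝ) (b : Bool) (f : List.Vector Bool (n + 1) → ℝ) :
    slice b (noiseOp ρ f) =
      ((1 + ρ) / 2) • noiseOp ρ (slice b f) + ((1 - ρ) / 2) • noiseOp ρ (slice (!b) f) := by
  funext c
  simp only [slice, noiseOp_apply, sum_eq_sum_slice, noiseWeight_cons, flipWeight, Pi.add_apply,
    Pi.smul_apply, smul_eq_mul, Finset.mul_sum, mul_assoc]
  cases b <;> simp [add_comm]

theorem ext_slice {f g : List.Vector Bool (n + 1) → ℝ} (h : ∀ b, slice b f = slice b g) :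
    f = g := by
  funext v
  obtain ⟨b, v, rfl⟩ := v.exists_eq_cons
  exact congrFun (h b) v

theorem noiseOp_one (ρ : ℝ) : noiseOp ρ (1 : List.Vector Bool n → ℝ) = 1 := by
  induction n with
  | zero => exact noiseOp_of_length_zero ρ 1
  | succ n ih =>
    refine ext_slice fun b => ?_
    have slice_one (a : Bool) : slice a (1 : List.Vector Bool (n + 1) → ℝ) = 1 := rfl
    simp only [slice_noiseOp, slice_one, ih]
    module

theorem noiseOp_noiseOp (ρ σ : ℝ) (f : List.Vector Bool n → ℝ) :
    noiseOp ρ (noiseOp σ f) = noiseOp (ρ * σ) f := by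
  induction n with
  | zero => simp only [noiseOp_of_length_zero]
  | succ n ih =>
    refine ext_slice fun b => ?_
    simp only [slice_noiseOp, map_add, map_smul, ih, Bool.not_not]
    module

theorem expect_noiseOp_mul (ρ : ℝ) (f g : List.Vector Bool n → ℝ) :
    𝔼 c, noiseOp ρ f c * g c = 𝔼 c, f c * noiseOp ρ g c := by
  simp only [noiseOp_apply, Fintype.expect_eq_sum_div_card, Finset.sum_mul, Finset.mul_sum]
  rw [Finset.sum_comm]
  congr! 3 with y _ c _
  rw [noiseWeight_comm]
  ring

theorem expect_noiseOp (ρ : ℝ) (f : List.Vector Bool n → ℝ) : 𝔼 c, noiseOp ρ f c = 𝔼 c, f c := by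
  simpa [noiseOp_one] using expect_noiseOp_mul ρ f 1

theorem noiseOp_mono {ρ : ℝ} (h0 : 0 ≤ ρ) (h1 : ρ ≤ 1) :
    Monotone (noiseOp ρ : (List.Vector Bool n → ℝ) → List.Vector Bool n → ℝ) := fun _ _ h c =>
  Finset.sum_le_sum fun y _ => mul_le_mul_of_nonneg_left (h y) (noiseWeight_nonneg h0 h1 c y)

theorem noiseOp_nonneg {ρ : ℝ} (h0 : 0 ≤ ρ) (h1 : ρ ≤ 1) {f : List.Vector Bool n → ℝ}
    (hf : 0 ≤ f) : 0 ≤ noiseOp ρ f :=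
  map_zero (noiseOp (n := n) ρ) ▸ noiseOp_mono h0 h1 hf

theorem noiseOp_le_of_le {ρ : ℝ} (h0 : 0 ≤ ρ) (h1 : ρ ≤ 1) {f : List.Vector Bool n → ℝ} {a : ℝ}
    (hf : ∀ v, f v ≤ a) (c : List.Vector Bool n) : noiseOp ρ f c ≤ a :=
  calc noiseOp ρ f c ≤ noiseOp ρ (a • 1) c := noiseOp_mono h0 h1 (fun v => by simpa using hf v) c
    _ = a := by simp [noiseOp_one]

end Noise

/-! ### Small-set expansion -/

section SmallSetExpansion

variable {n : ℕ}

/-- Small-set expansion of the noisy cubes of all dimensions, in the functional form with exponent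
`1 + 1 / m`; the power `m` is taken on both sides to keep the exponents integral. -/
def SmallSetExpansion (ρ : ℝ) (m : ℕ) : Prop :=
  ∀ (n : ℕ) (f : List.Vector Bool n → ℝ), 0 ≤ f → f ≤ 1 →
    (𝔼 c, noiseOp ρ f c ^ 2) ^ m ≤ (𝔼 c, f c) ^ (m + 1)

theorem SmallSetExpansion.expect_sq_le {ρ ε : ℝ} {m : ℕ} (h : SmallSetExpansion ρ m) (hm : m ≠ 0)
    (hε : 0 ≤ ε) {f : List.Vector Bool n → ℝ} (h0 : 0 ≤ f) (h1 : f ≤ 1) (hf : 𝔼 c, f c ≤ ε ^ m) :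
    𝔼 c, noiseOp ρ f c ^ 2 ≤ ε * 𝔼 c, f c := by
  have hmean : 0 ≤ 𝔼 c, f c := Finset.expect_nonneg fun c _ => h0 c
  refine le_of_pow_le_pow_left₀ hm (by positivity) ?_
  calc (𝔼 c, noiseOp ρ f c ^ 2) ^ m ≤ (𝔼 c, f c) ^ m * 𝔼 c, f c := h n f h0 h1
    _ ≤ (𝔼 c, f c) ^ m * ε ^ m := by gcongr
    _ = (ε * 𝔼 c, f c) ^ m := by rw [mul_pow, mul_comm]

theorem two_point_polynomial {x y : ℝ} (hx : 0 ≤ x) (hy : 0 ≤ y) :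
    ((5 * x ^ 6 + 6 * (x ^ 3 * y ^ 3) + 5 * y ^ 6) / 16) ^ 2 ≤ ((x ^ 4 + y ^ 4) / 2) ^ 3 := by
  have quadratic_nonneg (s t : ℝ) : 0 ≤ 14 * s ^ 2 - 32 * (s * t) + 27 * t ^ 2 := by
    nlinarith [sq_nonneg (14 * s - 16 * t), sq_nonneg t]
  have hxy := quadratic_nonneg (x ^ 2) (y ^ 2)
  have hyx := quadratic_nonneg (y ^ 2) (x ^ 2)
  have factorization : ((x ^ 4 + y ^ 4) / 2) ^ 3 -
      ((5 * x ^ 6 + 6 * (x ^ 3 * y ^ 3) + 5 * y ^ 6) / 16) ^ 2 = (x - y) ^ 2 *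
        (x ^ 5 * y * (14 * (x ^ 2) ^ 2 - 32 * (x ^ 2 * y ^ 2) + 27 * (y ^ 2) ^ 2) +
          x * y ^ 5 * (14 * (y ^ 2) ^ 2 - 32 * (y ^ 2 * x ^ 2) + 27 * (x ^ 2) ^ 2) +
          (7 * x ^ 10 + 21 * (x ^ 8 * y ^ 2) + 11 * (x ^ 6 * y ^ 4) + 11 * (x ^ 4 * y ^ 6) +
            21 * (x ^ 2 * y ^ 8) + 7 * y ^ 10)) / 256 := by ring
  rw [← sub_nonneg, factorization]
  positivity

theorem two_point_inequality {r a b A B D : ℝ} (hr0 : 0 ≤ r) (hr1 : r ≤ 1 / 2) (ha : 0 ≤ a)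
    (hb : 0 ≤ b) (hB : 0 ≤ B) (hAa : A ^ 2 ≤ a ^ 3) (hBb : B ^ 2 ≤ b ^ 3)
    (hD : D ^ 2 ≤ A * B) (h0 : 0 ≤ (1 + r ^ 2) / 4 * (A + B) + (1 - r ^ 2) / 2 * D) :
    ((1 + r ^ 2) / 4 * (A + B) + (1 - r ^ 2) / 2 * D) ^ 2 ≤ ((a + b) / 2) ^ 3 := by
  have exists_fourth_root {s : ℝ} (hs : 0 ≤ s) : ∃ x : ℝ, 0 ≤ x ∧ x ^ 4 = s :=
    ⟨√√s, by positivity, by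
      rw [show 4 = 2 * 2 from rfl, pow_mul, Real.sq_sqrt (by positivity), Real.sq_sqrt hs]⟩
  obtain ⟨x, hx, rfl⟩ := exists_fourth_root ha
  obtain ⟨y, hy, rfl⟩ := exists_fourth_root hb
  have hA' : A ≤ x ^ 6 := le_of_sq_le_sq (hAa.trans_eq (by ring)) (by positivity)
  have hB' : B ≤ y ^ 6 := le_of_sq_le_sq (hBb.trans_eq (by ring)) (by positivity)
  have hD' : D ≤ x ^ 3 * y ^ 3 := by
    refine le_of_sq_le_sq ?_ (by positivity)
    calc D ^ 2 ≤ A * B := hD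
      _ ≤ x ^ 6 * y ^ 6 := by gcongr
      _ = (x ^ 3 * y ^ 3) ^ 2 := by ring
  have hr : r ^ 2 ≤ 1 / 4 := by nlinarith
  have hsq : 0 ≤ (1 / 4 - r ^ 2) * (x ^ 3 - y ^ 3) ^ 2 := mul_nonneg (by linarith) (sq_nonneg _)
  refine (pow_le_pow_left₀ h0 ?_ 2).trans (two_point_polynomial hx hy)
  calc (1 + r ^ 2) / 4 * (A + B) + (1 - r ^ 2) / 2 * D
      ≤ (1 + r ^ 2) / 4 * (x ^ 6 + y ^ 6) + (1 - r ^ 2) / 2 * (x ^ 3 * y ^ 3) := by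
        have : 0 ≤ (1 - r ^ 2) / 2 := by linarith
        gcongr
    _ ≤ (5 * x ^ 6 + 6 * (x ^ 3 * y ^ 3) + 5 * y ^ 6) / 16 := by linarith

theorem expect_noiseOp_sq_eq_slices (r : ℝ) (f : List.Vector Bool (n + 1) → ℝ) :
    𝔼 c, noiseOp r f c ^ 2 =
      (1 + r ^ 2) / 4 *
        (𝔼 c, noiseOp r (slice true f) c ^ 2 + 𝔼 c, noiseOp r (slice false f) c ^ 2) +
      (1 - r ^ 2) / 2 * 𝔼 c, noiseOp r (slice true f) c * noiseOp r (slice false f) c := by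
  have slice_sq (b : Bool) (c : List.Vector Bool n) :
      slice b (fun c => noiseOp r f c ^ 2) c = slice b (noiseOp r f) c ^ 2 := rfl
  simp only [expect_eq_expect_slice, slice_sq, slice_noiseOp, Bool.not_true, Bool.not_false,
    Pi.add_apply, Pi.smul_apply, smul_eq_mul, ← Finset.expect_add_distrib, Finset.mul_expect,
    Finset.expect_div]
  refine Finset.expect_congr rfl fun c _ => ?_
  ring

theorem smallSetExpansion_two {r : ℝ} (hr0 : 0 ≤ r) (hr1 : r ≤ 1 / 2) : SmallSetExpansion r 2 := by
  intro n
  induction n with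
  | zero =>
    intro f h0 h1
    simp only [noiseOp_of_length_zero, Fintype.expect_eq_sum_div_card,
      Fintype.sum_subsingleton _ List.Vector.nil, card_vector, pow_zero, Nat.cast_one, div_one,
      ← pow_mul]
    exact pow_le_pow_of_le_one (h0 _) (h1 _) (by norm_num)
  | succ n ih =>
    intro f h0 h1
    have hslice (b : Bool) := ih (slice b f) (fun _ => h0 _) fun _ => h1 _
    have hmean (b : Bool) : 0 ≤ 𝔼 v, slice b f v := Finset.expect_nonneg fun _ _ => h0 _
    have hsq : 0 ≤ 𝔼 c, noiseOp r f c ^ 2 := Finset.expect_nonneg fun _ _ => sq_nonneg _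
    rw [expect_noiseOp_sq_eq_slices] at hsq ⊢
    rw [expect_eq_expect_slice f]
    exact two_point_inequality hr0 hr1 (hmean true) (hmean false)
      (Finset.expect_nonneg fun _ _ => sq_nonneg _) (hslice true) (hslice false)
      (Finset.expect_mul_sq_le_sq_mul_sq _ _ _) hsq

theorem expect_noiseOp_sq_sq_le (r : ℝ) {f : List.Vector Bool n → ℝ} (h0 : 0 ≤ f) (h1 : f ≤ 1) :
    (𝔼 c, noiseOp r f c ^ 2) ^ 2 ≤ (𝔼 c, f c) * 𝔼 c, noiseOp (r ^ 2) f c ^ 2 := by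
  calc (𝔼 c, noiseOp r f c ^ 2) ^ 2 = (𝔼 c, f c * noiseOp (r ^ 2) f c) ^ 2 := by
        rw [sq r, ← noiseOp_noiseOp, ← expect_noiseOp_mul]
        simp only [sq (noiseOp r f _)]
    _ ≤ (𝔼 c, f c ^ 2) * 𝔼 c, noiseOp (r ^ 2) f c ^ 2 := Finset.expect_mul_sq_le_sq_mul_sq _ _ _
    _ ≤ (𝔼 c, f c) * 𝔼 c, noiseOp (r ^ 2) f c ^ 2 := by
        have : 0 ≤ 𝔼 c, noiseOp (r ^ 2) f c ^ 2 := Finset.expect_nonneg fun _ _ => sq_nonneg _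
        gcongr with c
        exact pow_le_of_le_one (h0 c) (h1 c) two_ne_zero

theorem SmallSetExpansion.of_sq {r : ℝ} {m : ℕ} (h : SmallSetExpansion (r ^ 2) m) :
    SmallSetExpansion r (2 * m) := by
  intro n f h0 h1
  have hmean : 0 ≤ 𝔼 c, f c := Finset.expect_nonneg fun c _ => h0 c
  calc (𝔼 c, noiseOp r f c ^ 2) ^ (2 * m)
      ≤ ((𝔼 c, f c) * 𝔼 c, noiseOp (r ^ 2) f c ^ 2) ^ m := by
        rw [pow_mul]
        gcongr
        exact expect_noiseOp_sq_sq_le r h0 h1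
    _ ≤ (𝔼 c, f c) ^ m * (𝔼 c, f c) ^ (m + 1) := by
        rw [mul_pow]
        gcongr
        exact h n f h0 h1
    _ = (𝔼 c, f c) ^ (2 * m + 1) := by ring

theorem smallSetExpansion_two_pow {r : ℝ} {j : ℕ} (hr0 : 0 ≤ r) (hr1 : r ^ 2 ^ j ≤ 1 / 2) :
    SmallSetExpansion r (2 ^ (j + 1)) := by
  induction j generalizing r with
  | zero => exact smallSetExpansion_two hr0 (by simpa using hr1)
  | succ j ih =>
    rw [pow_succ']
    exact (ih (sq_nonneg r) (by rwa [← pow_mul, ← pow_succ'])).of_sq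

theorem exists_smallSetExpansion {c : ℝ} (hc : 0 < c) :
    ∃ m, m ≠ 0 ∧ ∀ r, 0 ≤ r → r ≤ 1 - c → SmallSetExpansion r m := by
  obtain ⟨j, hj⟩ := exists_pow_lt_of_lt_one (one_half_pos (α := ℝ)) (y := max 0 (1 - c))
    (max_lt one_pos (by linarith))
  refine ⟨2 ^ (j + 1), by positivity, fun r hr0 hr1 => smallSetExpansion_two_pow (j := j) hr0 ?_⟩
  calc r ^ 2 ^ j ≤ (max 0 (1 - c)) ^ 2 ^ j := by
        gcongr
        exact le_max_of_le_right hr1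
    _ ≤ (max 0 (1 - c)) ^ j :=
        pow_le_pow_of_le_one (le_max_left _ _) (max_le zero_le_one (by linarith))
          Nat.lt_two_pow_self.le
    _ ≤ 1 / 2 := hj.le

end SmallSetExpansion

/-! ### Uniform distributions on finite types -/

section UniformProb

variable {ι κ : Type*} [Fintype ι]

theorem expect_le_of_forall_le {f : ι → ℝ} {b : ℝ} (hb : 0 ≤ b) (h : ∀ i, f i ≤ b) :
    𝔼 i, f i ≤ b := by
  cases isEmpty_or_nonempty ι
  · simpa using hb
  · exact Finset.expect_le Finset.univ_nonempty fun i _ => h i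

open Classical in
/-- The probability of the event `P` for a uniformly random element of `ι`. -/
noncomputable def uniformProb (P : ι → Prop) : ℝ := 𝔼 i, if P i then 1 else 0

theorem uniformProb_eq_expect (P : ι → Prop) [DecidablePred P] :
    uniformProb P = 𝔼 i, if P i then (1 : ℝ) else 0 := by
  unfold uniformProb
  congr! 2

theorem uniformProb_nonneg (P : ι → Prop) : 0 ≤ uniformProb P :=
  Finset.expect_nonneg fun _ _ => by split_ifs <;> norm_num

theorem uniformProb_le_one (P : ι → Prop) : uniformProb P ≤ 1 :=
  expect_le_of_forall_le zero_le_one fun _ => by split_ifs <;> norm_num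

theorem uniformProb_pos {P : ι → Prop} {i : ι} (h : P i) : 0 < uniformProb P :=
  Finset.expect_pos' (fun _ _ => by split_ifs <;> norm_num) ⟨i, Finset.mem_univ i, by simp [h]⟩

theorem uniformProb_prod [Fintype κ] (P : ι × κ → Prop) :
    uniformProb P = 𝔼 i, uniformProb fun j => P (i, j) := by
  classical
  rw [uniformProb, ← Finset.univ_product_univ, Finset.expect_product]
  rfl

theorem sum_uniformProb_mem_le {T : ι → Finset κ} {q : ℕ} (hT : ∀ i, (T i).card ≤ q)
    (s : Finset κ) : ∑ x ∈ s, uniformProb (fun i => x ∈ T i) ≤ q := by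
  classical
  simp only [uniformProb_eq_expect]
  rw [← Finset.expect_sum_comm]
  refine expect_le_of_forall_le q.cast_nonneg fun i => ?_
  rw [Finset.sum_boole, Finset.filter_mem_eq_inter]
  exact_mod_cast (Finset.card_le_card Finset.inter_subset_right).trans (hT i)

end UniformProb

/-! ### Resampling a finite random function outside a stopping set -/

section Resampling

variable {X β α : Type*}

/-- The set `H ω` is determined by the values of `ω` on it. -/
def IsStopping (H : (X → β) → Finset X) : Prop :=
  ∀ ω ω', (∀ x ∈ H ω, ω x = ω' x) → H ω' = H ω

theorem isStopping_const (H : Finset X) : IsStopping fun _ : X → β => H := fun _ _ _ => rfl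

/-- A deterministic algorithm that queries a function `ω : X → β`, reduced to its output and the
set of its queries: both are determined by the answers to the queries. -/
structure QueryAlgorithm (X β α : Type*) where
  output : (X → β) → α
  queries : (X → β) → Finset X
  isLocal : ∀ ω ω', (∀ x ∈ queries ω, ω x = ω' x) → queries ω' = queries ω ∧ output ω' = output ω

theorem QueryAlgorithm.isStopping (A : QueryAlgorithm X β α) : IsStopping A.queries :=
  fun ω ω' h => (A.isLocal ω ω' h).1

variable [DecidableEq X]

/-- The function `ω`, resampled as `ω'` outside `H`. -/
def patch (H : Finset X) (ω ω' : X → β) : X → β := fun x => if x ∈ H then ω x else ω' x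

theorem patch_of_mem {H : Finset X} {ω ω' : X → β} {x : X} (h : x ∈ H) :
    patch H ω ω' x = ω x := if_pos h

theorem patch_congr {H : Finset X} {ω₁ ω₂ : X → β} (h : ∀ x ∈ H, ω₁ x = ω₂ x) (ω' : X → β) :
    patch H ω₁ ω' = patch H ω₂ ω' := by
  funext x
  by_cases hx : x ∈ H <;> simp [patch, hx, h]

theorem IsStopping.apply_patch {H : (X → β) → Finset X} (hH : IsStopping H) (ω ω' : X → β) :
    H (patch (H ω) ω ω') = H ω :=
  hH _ _ fun _ hx => (patch_of_mem hx).symm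

theorem QueryAlgorithm.output_patch (A : QueryAlgorithm X β α) {H : Finset X} {ω : X → β}
    (hH : A.queries ω ⊆ H) (ω' : X → β) : A.output (patch H ω ω') = A.output ω :=
  (A.isLocal _ _ fun _ hx => (patch_of_mem (hH hx)).symm).2

variable [Fintype X] [Fintype β] [Nonempty β]

theorem expect_patch {H : (X → β) → Finset X} (hH : IsStopping H) (f : (X → β) → ℝ) :
    𝔼 ω, 𝔼 ω', f (patch (H ω) ω ω') = 𝔼 ω, f ω := by
  have swap_involutive : Function.Involutive fun p : (X → β) × (X → β) =>
      (patch (H p.1) p.1 p.2, patch (H p.1) p.2 p.1) := by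
    rintro ⟨ω, ω'⟩
    simp only [hH.apply_patch, Prod.mk.injEq]
    constructor <;> funext x <;> by_cases hx : x ∈ H ω <;> simp [patch, hx]
  calc 𝔼 ω, 𝔼 ω', f (patch (H ω) ω ω') = 𝔼 p : (X → β) × (X → β), f (patch (H p.1) p.1 p.2) := by
        rw [← Finset.univ_product_univ, Finset.expect_product]
    _ = 𝔼 p : (X → β) × (X → β), f p.1 :=
        Fintype.expect_equiv swap_involutive.toPerm _ _ fun _ => rfl
    _ = 𝔼 ω, f ω := by simp [← Finset.univ_product_univ, Finset.expect_product]

theorem uniformProb_agree_mul_expect_patch [DecidableEq β] (H : Finset X) (ω₀ : X → β)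
    (f : (X → β) → ℝ) :
    (uniformProb fun ω : X → β => ∀ x ∈ H, ω x = ω₀ x) * 𝔼 ω', f (patch H ω₀ ω') =
      𝔼 ω, if ∀ x ∈ H, ω x = ω₀ x then f ω else 0 := by
  have resample := expect_patch (isStopping_const H)
    fun ω : X → β => if ∀ x ∈ H, ω x = ω₀ x then f ω else 0
  rw [← resample, uniformProb_eq_expect, Finset.expect_mul]
  refine Finset.expect_congr rfl fun ω _ => ?_
  have agree_patch (ω' : X → β) :
      (∀ x ∈ H, patch H ω ω' x = ω₀ x) ↔ ∀ x ∈ H, ω x = ω₀ x :=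
    forall₂_congr fun x hx => by rw [patch_of_mem hx]
  by_cases hω : ∀ x ∈ H, ω x = ω₀ x
  · have patch_eq (ω' : X → β) : patch H ω ω' = patch H ω₀ ω' := patch_congr hω ω'
    simp only [agree_patch, if_pos hω, one_mul]
    simp only [patch_eq]
  · simp [agree_patch, hω]

end Resampling

/-! ### Learning the heavy points -/

section Learning

variable {X β : Type*} [DecidableEq X]

open Classical in
/-- The set `H ω`, enlarged by `x₀` if `ω` agrees with `ω₀` on `H ω`. -/
noncomputable def insertOn (H : (X → β) → Finset X) (ω₀ : X → β) (x₀ : X) (ω : X → β) : Finset X :=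
  if ∀ x ∈ H ω, ω x = ω₀ x then insert x₀ (H ω) else H ω

theorem insertOn_of_agree {H : (X → β) → Finset X} {ω₀ ω : X → β}
    (h : ∀ x ∈ H ω, ω x = ω₀ x) (x₀ : X) : insertOn H ω₀ x₀ ω = insert x₀ (H ω) := if_pos h

theorem insertOn_of_not_agree {H : (X → β) → Finset X} {ω₀ ω : X → β}
    (h : ¬ ∀ x ∈ H ω, ω x = ω₀ x) (x₀ : X) : insertOn H ω₀ x₀ ω = H ω := if_neg h

theorem subset_insertOn (H : (X → β) → Finset X) (ω₀ : X → β) (x₀ : X) (ω : X → β) :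
    H ω ⊆ insertOn H ω₀ x₀ ω := by
  unfold insertOn
  split_ifs
  exacts [Finset.subset_insert _ _, subset_rfl]

theorem IsStopping.insertOn {H : (X → β) → Finset X} (hH : IsStopping H) (ω₀ : X → β) (x₀ : X) :
    IsStopping (insertOn H ω₀ x₀) := by
  intro ω ω' h
  have hagree : ∀ x ∈ H ω, ω x = ω' x := fun x hx => h x (subset_insertOn H ω₀ x₀ ω hx)
  have hHω : H ω' = H ω := hH ω ω' hagree
  have hcond : (∀ x ∈ H ω', ω' x = ω₀ x) ↔ ∀ x ∈ H ω, ω x = ω₀ x := by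
    rw [hHω]
    exact forall₂_congr fun x hx => by rw [hagree x hx]
  by_cases hω : ∀ x ∈ H ω, ω x = ω₀ x
  · rw [insertOn_of_agree hω, insertOn_of_agree (hcond.2 hω), hHω]
  · rw [insertOn_of_not_agree hω, insertOn_of_not_agree (hcond.not.2 hω), hHω]

variable [Fintype X] [Fintype β] [Nonempty β]

/-- The quantity maximised by the learned set: points pay `w ω x` and cost `τ`. -/
noncomputable def learningGain (w : (X → β) → X → ℝ) (τ : ℝ) (H : (X → β) → Finset X) : ℝ :=
  𝔼 ω, ∑ x ∈ H ω, (w ω x - τ)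

theorem learningGain_insertOn (w : (X → β) → X → ℝ) (τ : ℝ) {H : (X → β) → Finset X}
    (hH : IsStopping H) {ω₀ : X → β} {x₀ : X} (hx₀ : x₀ ∉ H ω₀) :
    learningGain w τ (insertOn H ω₀ x₀) = learningGain w τ H +
      (uniformProb fun ω : X → β => ∀ x ∈ H ω₀, ω x = ω₀ x) *
        𝔼 ω', (w (patch (H ω₀) ω₀ ω') x₀ - τ) := by
  classical
  rw [uniformProb_agree_mul_expect_patch (H ω₀) ω₀ fun ω => w ω x₀ - τ]
  simp only [learningGain]
  rw [← Finset.expect_add_distrib]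
  refine Finset.expect_congr rfl fun ω _ => ?_
  by_cases hω : ∀ x ∈ H ω₀, ω x = ω₀ x
  · have hHω : H ω = H ω₀ := hH ω₀ ω fun x hx => (hω x hx).symm
    rw [insertOn_of_agree (by rwa [hHω]), hHω, if_pos hω, Finset.sum_insert hx₀, add_comm]
  · have hHω : ¬ ∀ x ∈ H ω, ω x = ω₀ x := fun h => hω (by rwa [hH ω ω₀ h])
    rw [insertOn_of_not_agree hHω, if_neg hω, add_zero]

theorem exists_stopping_superset {w : (X → β) → X → ℝ} {q q₀ τ : ℝ} (hτ : 0 < τ)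
    (hw : ∀ ω x, 0 ≤ w ω x) (hsum : ∀ ω, ∑ x, w ω x ≤ q) {H₀ : (X → β) → Finset X}
    (hH₀ : IsStopping H₀) (hcard : ∀ ω, ((H₀ ω).card : ℝ) ≤ q₀) :
    ∃ H : (X → β) → Finset X, IsStopping H ∧ (∀ ω, H₀ ω ⊆ H ω) ∧
      𝔼 ω, ((H ω).card : ℝ) ≤ q₀ + q / τ ∧
      ∀ ω, ∀ x ∉ H ω, 𝔼 ω', w (patch (H ω) ω ω') x ≤ τ := by
  classical
  -- Adding to a maximiser of the gain a point that it has not learned cannot increase the gain, so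
  -- no such point is heavy.
  obtain ⟨H, ⟨hH, hsub⟩, hmax⟩ := Set.exists_max_image
    {H : (X → β) → Finset X | IsStopping H ∧ ∀ ω, H₀ ω ⊆ H ω} (learningGain w τ) (Set.toFinite _)
    ⟨H₀, hH₀, fun _ => subset_rfl⟩
  refine ⟨H, hH, hsub, ?_, fun ω₀ x₀ hx₀ => ?_⟩
  · have gain_H₀_ge : -(τ * q₀) ≤ learningGain w τ H₀ := by
      refine Finset.le_expect Finset.univ_nonempty fun ω _ => ?_
      rw [Finset.sum_sub_distrib, Finset.sum_const, nsmul_eq_mul]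
      nlinarith [Finset.sum_nonneg fun x (_ : x ∈ H₀ ω) => hw ω x, hcard ω]
    have gain_H_le : learningGain w τ H ≤ q - τ * 𝔼 ω, ((H ω).card : ℝ) := by
      rw [Finset.mul_expect, ← Fintype.expect_const (ι := X → β) q, ← Finset.expect_sub_distrib]
      refine Finset.expect_le_expect fun ω _ => ?_
      rw [Finset.sum_sub_distrib, Finset.sum_const, nsmul_eq_mul, mul_comm]
      gcongr
      exact (Finset.sum_le_univ_sum_of_nonneg (hw ω)).trans (hsum ω)
    have hle := hmax H₀ ⟨hH₀, fun _ => subset_rfl⟩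
    rw [← sub_le_iff_le_add', le_div_iff₀ hτ]
    linarith
  · by_contra! hheavy
    have hle := hmax (insertOn H ω₀ x₀)
      ⟨hH.insertOn ω₀ x₀, fun ω => (hsub ω).trans (subset_insertOn H ω₀ x₀ ω)⟩
    rw [learningGain_insertOn w τ hH hx₀, Finset.expect_sub_distrib, Fintype.expect_const] at hle
    have hpos := uniformProb_pos (P := fun ω : X → β => ∀ x ∈ H ω₀, ω x = ω₀ x) fun _ _ => rfl
    nlinarith [mul_pos hpos (sub_pos.2 hheavy)]

end Learning

/-! ### The test statistic of a decoder -/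

section Decoder

variable {X β Dr : Type*} [Fintype Dr] {n : ℕ}
  (D : Dr → List.Vector Bool n → QueryAlgorithm X β Bool)

/-- The probability that the decoder `D` with random function `ω` accepts the string `y`. -/
noncomputable def acceptProb (ω : X → β) (y : List.Vector Bool n) : ℝ :=
  uniformProb fun d => (D d y).output ω = true

/-- The probability that the decoder `D` with random function `ω` queries `x` on the string `y`. -/
noncomputable def queryProb (ω : X → β) (x : X) (y : List.Vector Bool n) : ℝ :=
  uniformProb fun d => x ∈ (D d y).queries ω

theorem sum_queryProb_le {q : ℕ} (hq : ∀ d y ω, ((D d y).queries ω).card ≤ q) (s : Finset X)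
    (ω : X → β) (y : List.Vector Bool n) : ∑ x ∈ s, queryProb D ω x y ≤ q :=
  sum_uniformProb_mem_le (fun d => hq d y ω) s

variable [DecidableEq X] [Fintype X] [Fintype β]

/-- The probability that the decoder accepts, conditioned on the random function agreeing with `ω`
on `H`. -/
noncomputable def condAcceptProb (H : Finset X) (ω : X → β) (y : List.Vector Bool n) : ℝ :=
  𝔼 ω', acceptProb D (patch H ω ω') y

/-- The probability that the decoder queries `x`, conditioned on the random function agreeing with
`ω` on `H`. -/
noncomputable def condQueryProb (H : Finset X) (ω : X → β) (x : X) (y : List.Vector Bool n) : ℝ :=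
  𝔼 ω', queryProb D (patch H ω ω') x y

/-- The statistic by which encodings are told from uniform strings when the random function is known
on `H`.  The second term is large only if the decoder is likely to query points outside `H`. -/
noncomputable def statistic (ρ ε : ℝ) (H : Finset X) (ω : X → β) (c : List.Vector Bool n) : ℝ :=
  noiseOp ρ (condAcceptProb D H ω) c + (∑ x ∈ Hᶜ, noiseOp ρ (condQueryProb D H ω x) c ^ 2) / ε

theorem statistic_congr (ρ ε : ℝ) {H : Finset X} {ω₁ ω₂ : X → β} (h : ∀ x ∈ H, ω₁ x = ω₂ x) :
    statistic D ρ ε H ω₁ = statistic D ρ ε H ω₂ := by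
  unfold statistic condAcceptProb condQueryProb
  simp only [patch_congr h]

theorem condAcceptProb_nonneg (H : Finset X) (ω : X → β) : 0 ≤ condAcceptProb D H ω :=
  fun _ => Finset.expect_nonneg fun _ _ => uniformProb_nonneg _

theorem condAcceptProb_le_one (H : Finset X) (ω : X → β) (y : List.Vector Bool n) :
    condAcceptProb D H ω y ≤ 1 :=
  expect_le_of_forall_le zero_le_one fun _ => uniformProb_le_one _

theorem condQueryProb_nonneg (H : Finset X) (ω : X → β) (x : X) : 0 ≤ condQueryProb D H ω x :=
  fun _ => Finset.expect_nonneg fun _ _ => uniformProb_nonneg _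

theorem condQueryProb_le_one (H : Finset X) (ω : X → β) (x : X) (y : List.Vector Bool n) :
    condQueryProb D H ω x y ≤ 1 :=
  expect_le_of_forall_le zero_le_one fun _ => uniformProb_le_one _

variable {ρ ε : ℝ}

theorem statistic_nonneg (h0 : 0 ≤ ρ) (h1 : ρ ≤ 1) (hε : 0 < ε) (H : Finset X) (ω : X → β)
    (c : List.Vector Bool n) : 0 ≤ statistic D ρ ε H ω c :=
  add_nonneg (noiseOp_nonneg h0 h1 (condAcceptProb_nonneg D H ω) c)
    (div_nonneg (Finset.sum_nonneg fun _ _ => sq_nonneg _) hε.le)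

variable {D} {q : ℕ}

theorem sum_condQueryProb_le (hq : ∀ d y ω, ((D d y).queries ω).card ≤ q) (H s : Finset X)
    (ω : X → β) (y : List.Vector Bool n) : ∑ x ∈ s, condQueryProb D H ω x y ≤ q := by
  simp only [condQueryProb]
  rw [← Finset.expect_sum_comm]
  exact expect_le_of_forall_le q.cast_nonneg fun _ => sum_queryProb_le D hq _ _ _

theorem statistic_le (h0 : 0 ≤ ρ) (h1 : ρ ≤ 1) (hε : 0 < ε)
    (hq : ∀ d y ω, ((D d y).queries ω).card ≤ q) (H : Finset X) (ω : X → β)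
    (c : List.Vector Bool n) : statistic D ρ ε H ω c ≤ 1 + q / ε := by
  refine add_le_add (noiseOp_le_of_le h0 h1 (condAcceptProb_le_one D H ω) c) ?_
  gcongr
  calc ∑ x ∈ Hᶜ, noiseOp ρ (condQueryProb D H ω x) c ^ 2
      ≤ ∑ x ∈ Hᶜ, noiseOp ρ (condQueryProb D H ω x) c := by
        refine Finset.sum_le_sum fun x _ => pow_le_of_le_one ?_ ?_ two_ne_zero
        · exact noiseOp_nonneg h0 h1 (condQueryProb_nonneg D H ω x) c
        · exact noiseOp_le_of_le h0 h1 (condQueryProb_le_one D H ω x) c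
    _ = noiseOp ρ (∑ x ∈ Hᶜ, condQueryProb D H ω x) c := by rw [map_sum, Finset.sum_apply]
    _ ≤ q := noiseOp_le_of_le h0 h1 (fun y => by
        rw [Finset.sum_apply]
        exact sum_condQueryProb_le hq H Hᶜ ω y) c

theorem expect_statistic_le {m : ℕ} (hsse : SmallSetExpansion ρ m) (hm : m ≠ 0) (hε : 0 < ε)
    (hq : ∀ d y ω, ((D d y).queries ω).card ≤ q) {H : Finset X} {ω : X → β}
    (hlight : ∀ x ∉ H, 𝔼 y, condQueryProb D H ω x y ≤ (ε ^ 2) ^ m) :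
    𝔼 c, statistic D ρ ε H ω c ≤ 𝔼 y, condAcceptProb D H ω y + q * ε := by
  simp only [statistic]
  rw [Finset.expect_add_distrib, expect_noiseOp, ← Finset.expect_div, Finset.expect_sum_comm]
  gcongr
  rw [div_le_iff₀ hε]
  calc ∑ x ∈ Hᶜ, 𝔼 c, noiseOp ρ (condQueryProb D H ω x) c ^ 2
      ≤ ∑ x ∈ Hᶜ, ε ^ 2 * 𝔼 y, condQueryProb D H ω x y :=
        Finset.sum_le_sum fun x hx => hsse.expect_sq_le hm (sq_nonneg ε)
          (condQueryProb_nonneg D H ω x) (condQueryProb_le_one D H ω x)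
          (hlight x (Finset.mem_compl.1 hx))
    _ = ε ^ 2 * 𝔼 y, ∑ x ∈ Hᶜ, condQueryProb D H ω x y := by
        rw [Finset.expect_sum_comm, Finset.mul_sum]
    _ ≤ ε ^ 2 * q := by
        gcongr
        exact expect_le_of_forall_le q.cast_nonneg fun y => sum_condQueryProb_le hq H _ ω y
    _ = q * ε * ε := by ring

end Decoder

section HybridArgument

variable {X β Dr : Type*} [Fintype Dr] {n : ℕ}

theorem QueryAlgorithm.exists_mem_queries_of_output_ne {α : Type*} (A : QueryAlgorithm X β α)
    {ω ω' : X → β} (h : A.output ω' ≠ A.output ω) : ∃ x ∈ A.queries ω, ω x ≠ ω' x := by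
  by_contra! hagree
  exact h (A.isLocal ω ω' hagree).2

theorem uniformProb_le_add_sum {ι : Type*} [Fintype ι] {P Q : ι → Prop} {T : ι → Finset X}
    {s : Finset X} (h : ∀ i, P i → ¬ Q i → ∃ x ∈ s, x ∈ T i) :
    uniformProb P ≤ uniformProb Q + ∑ x ∈ s, uniformProb fun i => x ∈ T i := by
  classical
  simp only [uniformProb_eq_expect]
  rw [← Finset.expect_sum_comm, ← Finset.expect_add_distrib]
  refine Finset.expect_le_expect fun i _ => ?_
  rw [Finset.sum_boole]
  by_cases hP : P i <;> by_cases hQ : Q i <;> simp only [hP, hQ, if_true, if_false, zero_add]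
  · simp
  · obtain ⟨x, hx, hxT⟩ := h i hP hQ
    exact_mod_cast Finset.card_pos.2 ⟨x, Finset.mem_filter.2 ⟨hx, hxT⟩⟩
  all_goals positivity

variable [DecidableEq X] (D : Dr → List.Vector Bool n → QueryAlgorithm X β Bool)

theorem acceptProb_patch_union_le (H Q : Finset X) (ω ω' : X → β) (y : List.Vector Bool n) :
    acceptProb D (patch (H ∪ Q) ω ω') y ≤
      acceptProb D (patch H ω ω') y + ∑ x ∈ Q \ H, queryProb D (patch H ω ω') x y := by
  refine uniformProb_le_add_sum fun d hd hd' => ?_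
  obtain ⟨x, hx, hne⟩ := (D d y).exists_mem_queries_of_output_ne fun h => hd' (h ▸ hd)
  refine ⟨x, ?_, hx⟩
  by_contra hxQ
  by_cases hxH : x ∈ H <;> simp_all [patch]

variable [Fintype X] [Fintype β]

theorem condAcceptProb_union_le (H Q : Finset X) (ω : X → β) :
    condAcceptProb D (H ∪ Q) ω ≤ condAcceptProb D H ω + ∑ x ∈ Q \ H, condQueryProb D H ω x := by
  intro y
  simp only [Pi.add_apply, Finset.sum_apply, condAcceptProb, condQueryProb]
  rw [← Finset.expect_sum_comm, ← Finset.expect_add_distrib]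
  exact Finset.expect_le_expect fun ω' _ => acceptProb_patch_union_le D H Q ω ω' y

theorem noiseOp_condAcceptProb (ρ : ℝ) (H : Finset X) (ω : X → β) (c : List.Vector Bool n) :
    noiseOp ρ (condAcceptProb D H ω) c = 𝔼 ω', noiseOp ρ (acceptProb D (patch H ω ω')) c := by
  simp only [noiseOp_apply, condAcceptProb, Finset.mul_expect]
  rw [Finset.expect_sum_comm]

theorem le_sq_div_add {ε : ℝ} (hε : 0 < ε) (t : ℝ) : t ≤ t ^ 2 / ε + ε := by
  have complete_square : t ^ 2 / ε + ε - t = ((t - ε / 2) ^ 2 + 3 / 4 * ε ^ 2) / ε := by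
    field_simp
    ring
  rw [← sub_nonneg, complete_square]
  positivity

theorem noiseOp_condAcceptProb_union_le {ρ ε : ℝ} {q : ℕ} (h0 : 0 ≤ ρ) (h1 : ρ ≤ 1) (hε : 0 < ε)
    (H : Finset X) {Q : Finset X} (hQ : Q.card ≤ q) (ω : X → β) (c : List.Vector Bool n) :
    noiseOp ρ (condAcceptProb D (H ∪ Q) ω) c ≤ statistic D ρ ε H ω c + q * ε := by
  calc noiseOp ρ (condAcceptProb D (H ∪ Q) ω) c
      ≤ noiseOp ρ (condAcceptProb D H ω + ∑ x ∈ Q \ H, condQueryProb D H ω x) c :=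
        noiseOp_mono h0 h1 (condAcceptProb_union_le D H Q ω) c
    _ = noiseOp ρ (condAcceptProb D H ω) c + ∑ x ∈ Q \ H, noiseOp ρ (condQueryProb D H ω x) c := by
        rw [map_add, map_sum, Pi.add_apply, Finset.sum_apply]
    _ ≤ noiseOp ρ (condAcceptProb D H ω) c +
          ∑ x ∈ Q \ H, (noiseOp ρ (condQueryProb D H ω x) c ^ 2 / ε + ε) := by
        gcongr
        exact le_sq_div_add hε _
    _ ≤ statistic D ρ ε H ω c + q * ε := by
        rw [Finset.sum_add_distrib, Finset.sum_const, nsmul_eq_mul, ← Finset.sum_div, statistic,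
          add_assoc]
        gcongr
        · exact fun x hx => Finset.mem_compl.2 (Finset.mem_sdiff.1 hx).2
        · exact (Finset.card_le_card Finset.sdiff_subset).trans hQ

end HybridArgument

/-! ### Codes relative to a finite random function -/

/-- The algorithms of a code with codeword length `n` relative to a random function `X → β`; `Kr`,
`Er` and `Dr` are the random coins of the key generation, of the encoder for a fixed message, and of
the decoder, which accepts when it outputs that message. -/
structure FiniteCode (X β K Kr Er Dr : Type*) (n : ℕ) where
  key : Kr → QueryAlgorithm X β K
  enc : K → Er → QueryAlgorithm X β (List.Vector Bool n)
  dec : K → Dr → List.Vector Bool n → QueryAlgorithm X β Bool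
  maxQueries : ℕ
  card_key_le : ∀ r ω, ((key r).queries ω).card ≤ maxQueries
  card_enc_le : ∀ k e ω, ((enc k e).queries ω).card ≤ maxQueries
  card_dec_le : ∀ k d y ω, ((dec k d y).queries ω).card ≤ maxQueries

namespace FiniteCode

variable {X β K Kr Er Dr : Type*} [DecidableEq X] {n : ℕ} (S : FiniteCode X β K Kr Er Dr n)
  {H : (X → β) → Finset X} {r : Kr}

theorem isStopping_union_enc_queries (hH : IsStopping H) (hkey : ∀ ω, (S.key r).queries ω ⊆ H ω)
    (e : Er) : IsStopping fun ω => H ω ∪ (S.enc ((S.key r).output ω) e).queries ω := by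
  intro ω ω' h
  have agree_H : ∀ x ∈ H ω, ω x = ω' x := fun x hx => h x (Finset.mem_union_left _ hx)
  have agree_enc := fun x hx => h x (Finset.mem_union_right (H ω) hx)
  have key_eq := ((S.key r).isLocal ω ω' fun x hx => agree_H x (hkey ω hx)).2
  simp only [hH ω ω' agree_H, key_eq, (S.enc _ e).isStopping ω ω' agree_enc]

variable [Fintype X] [Fintype β] [Fintype Dr]

/-- The probability that the decoder accepts the encoding of the fixed message after it has passed
through the channel with correlation `ρ`. -/
noncomputable def completeness [Fintype Kr] [Fintype Er] (ρ : ℝ) : ℝ :=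
  𝔼 r, 𝔼 ω, 𝔼 e, noiseOp ρ (acceptProb (S.dec ((S.key r).output ω)) ω)
    ((S.enc ((S.key r).output ω) e).output ω)

/-- The probability that the decoder accepts the fixed string `y`. -/
noncomputable def falseAcceptance [Fintype Kr] (y : List.Vector Bool n) : ℝ :=
  𝔼 r, 𝔼 ω, acceptProb (S.dec ((S.key r).output ω)) ω y

/-- The advantage of encodings over uniform strings in the mean of the statistic, for the key
generated with coins `r` and the learned set `H`. -/
noncomputable def statisticGap [Fintype Er] (ρ ε : ℝ) (r : Kr) (H : (X → β) → Finset X)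
    (ω : X → β) : ℝ :=
  𝔼 e, statistic (S.dec ((S.key r).output ω)) ρ ε (H ω) ω
      ((S.enc ((S.key r).output ω) e).output ω) -
    𝔼 c, statistic (S.dec ((S.key r).output ω)) ρ ε (H ω) ω c

variable [Nonempty β]

theorem exists_learned_set (r : Kr) {τ : ℝ} (hτ : 0 < τ) :
    ∃ H : (X → β) → Finset X, IsStopping H ∧ (∀ ω, (S.key r).queries ω ⊆ H ω) ∧
      𝔼 ω, ((H ω).card : ℝ) ≤ S.maxQueries + S.maxQueries / τ ∧
      ∀ ω, ∀ x ∉ H ω, 𝔼 y, condQueryProb (S.dec ((S.key r).output ω)) (H ω) ω x y ≤ τ := by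
  obtain ⟨H, hH, hkey, hcard, hlight⟩ := exists_stopping_superset hτ
    (w := fun ω x => 𝔼 y, queryProb (S.dec ((S.key r).output ω)) ω x y) (q := S.maxQueries)
    (fun ω x => Finset.expect_nonneg fun _ _ => uniformProb_nonneg _)
    (fun ω => by
      rw [← Finset.expect_sum_comm]
      exact expect_le_of_forall_le (Nat.cast_nonneg _) fun y =>
        sum_queryProb_le _ (S.card_dec_le _) _ _ y)
    (S.key r).isStopping fun ω => Nat.cast_le.2 (S.card_key_le r ω)
  refine ⟨H, hH, hkey, hcard, fun ω x hx => ?_⟩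
  simp only [condQueryProb]
  rw [Finset.expect_comm]
  simpa only [(S.key r).output_patch (hkey ω)] using hlight ω x hx

theorem expect_condAcceptProb (hH : IsStopping H) (hkey : ∀ ω, (S.key r).queries ω ⊆ H ω)
    (y : List.Vector Bool n) :
    𝔼 ω, condAcceptProb (S.dec ((S.key r).output ω)) (H ω) ω y =
      𝔼 ω, acceptProb (S.dec ((S.key r).output ω)) ω y := by
  rw [← expect_patch hH fun ω => acceptProb (S.dec ((S.key r).output ω)) ω y]
  simp only [(S.key r).output_patch (hkey _), condAcceptProb]

theorem expect_noiseOp_acceptProb_le {ρ ε : ℝ} (h0 : 0 ≤ ρ) (h1 : ρ ≤ 1) (hε : 0 < ε)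
    (hH : IsStopping H) (hkey : ∀ ω, (S.key r).queries ω ⊆ H ω) (e : Er) :
    𝔼 ω, noiseOp ρ (acceptProb (S.dec ((S.key r).output ω)) ω)
        ((S.enc ((S.key r).output ω) e).output ω) ≤
      𝔼 ω, statistic (S.dec ((S.key r).output ω)) ρ ε (H ω) ω
        ((S.enc ((S.key r).output ω) e).output ω) + S.maxQueries * ε := by
  rw [← expect_patch (S.isStopping_union_enc_queries hH hkey e) fun ω =>
      noiseOp ρ (acceptProb (S.dec ((S.key r).output ω)) ω)
        ((S.enc ((S.key r).output ω) e).output ω),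
    ← Fintype.expect_const (ι := X → β) (S.maxQueries * ε), ← Finset.expect_add_distrib]
  refine Finset.expect_le_expect fun ω _ => ?_
  have hle := noiseOp_condAcceptProb_union_le (S.dec ((S.key r).output ω)) h0 h1 hε (H ω)
    (S.card_enc_le ((S.key r).output ω) e ω) ω ((S.enc ((S.key r).output ω) e).output ω)
  rw [noiseOp_condAcceptProb] at hle
  simpa only [(S.key r).output_patch ((hkey ω).trans Finset.subset_union_left),
    (S.enc _ e).output_patch Finset.subset_union_right] using hle

variable [Fintype Er] [Nonempty Er]

theorem exists_le_expect_statisticGap {ρ ε : ℝ} {m : ℕ} (h0 : 0 ≤ ρ) (h1 : ρ ≤ 1)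
    (hsse : SmallSetExpansion ρ m) (hm : m ≠ 0) (hε : 0 < ε) (r : Kr) :
    ∃ H : (X → β) → Finset X,
      𝔼 ω, ((H ω).card : ℝ) ≤ S.maxQueries + S.maxQueries / (ε ^ 2) ^ m ∧
      𝔼 ω, 𝔼 e, noiseOp ρ (acceptProb (S.dec ((S.key r).output ω)) ω)
          ((S.enc ((S.key r).output ω) e).output ω) ≤
        𝔼 y, 𝔼 ω, acceptProb (S.dec ((S.key r).output ω)) ω y + 2 * S.maxQueries * ε +
          𝔼 ω, S.statisticGap ρ ε r H ω := by
  obtain ⟨H, hH, hkey, hcard, hlight⟩ := S.exists_learned_set r (τ := (ε ^ 2) ^ m) (by positivity)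
  refine ⟨H, hcard, ?_⟩
  have encodings_ge := Finset.expect_le_expect (s := Finset.univ) fun e (_ : e ∈ Finset.univ) =>
    S.expect_noiseOp_acceptProb_le h0 h1 hε hH hkey e
  have uniform_le := Finset.expect_le_expect (s := Finset.univ) fun ω (_ : ω ∈ Finset.univ) =>
    expect_statistic_le hsse hm hε (S.card_dec_le _) (hlight ω)
  rw [Finset.expect_add_distrib, Fintype.expect_const, Finset.expect_comm,
    Finset.expect_comm _ _ fun e ω => statistic _ _ _ _ _ _] at encodings_ge
  rw [Finset.expect_add_distrib, Fintype.expect_const, Finset.expect_comm _ _ fun ω y =>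
    condAcceptProb _ _ _ _] at uniform_le
  simp only [S.expect_condAcceptProb hH hkey] at uniform_le
  simp only [statisticGap]
  rw [Finset.expect_sub_distrib]
  linarith

theorem exists_completeness_le [Fintype Kr] [Nonempty Kr] {ρ ε : ℝ} {m : ℕ} (h0 : 0 ≤ ρ)
    (h1 : ρ ≤ 1) (hsse : SmallSetExpansion ρ m) (hm : m ≠ 0) (hε : 0 < ε) :
    ∃ H : Kr → (X → β) → Finset X,
      (∀ r, 𝔼 ω, ((H r ω).card : ℝ) ≤ S.maxQueries + S.maxQueries / (ε ^ 2) ^ m) ∧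
      S.completeness ρ ≤ 𝔼 y, S.falseAcceptance y + 2 * S.maxQueries * ε +
        𝔼 r, 𝔼 ω, S.statisticGap ρ ε r (H r) ω := by
  choose H hcard hgap using S.exists_le_expect_statisticGap h0 h1 hsse hm hε
  refine ⟨H, hcard, ?_⟩
  have hle := Finset.expect_le_expect (s := Finset.univ) fun r (_ : r ∈ Finset.univ) => hgap r
  rw [Finset.expect_add_distrib, Finset.expect_add_distrib, Fintype.expect_const,
    Finset.expect_comm _ _ fun r y => 𝔼 ω, acceptProb (S.dec ((S.key r).output ω)) ω y] at hle
  exact hle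

end FiniteCode

/-! ### Testing many statistics on independent samples -/

section Markov

variable {ι : Type*} [Fintype ι]

theorem uniformProb_mono {P Q : ι → Prop} (h : ∀ i, P i → Q i) : uniformProb P ≤ uniformProb Q := by
  classical
  simp only [uniformProb_eq_expect]
  refine Finset.expect_le_expect fun i _ => ?_
  by_cases hP : P i
  · simp [hP, h i hP]
  · simp only [hP, if_false]
    positivity

theorem uniformProb_or_le (P Q : ι → Prop) :
    uniformProb (fun i => P i ∨ Q i) ≤ uniformProb P + uniformProb Q := by
  classical
  simp only [uniformProb_eq_expect]
  rw [← Finset.expect_add_distrib]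
  refine Finset.expect_le_expect fun i _ => ?_
  by_cases hP : P i <;> by_cases hQ : Q i <;> simp [hP, hQ]

theorem uniformProb_exists_le {Θ : Type*} [Fintype Θ] (P : Θ → ι → Prop) :
    uniformProb (fun i => ∃ θ, P θ i) ≤ ∑ θ, uniformProb (P θ) := by
  classical
  have prob_false : uniformProb (fun _ : ι => False) = 0 := by simp [uniformProb]
  simpa [prob_false] using uniformProb_le_add_sum (P := fun i => ∃ θ, P θ i) (Q := fun _ => False)
    (T := fun i => {θ | P θ i}) (s := Finset.univ) (by simp)

theorem uniformProb_true [Nonempty ι] : uniformProb (fun _ : ι => True) = 1 := by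
  simp [uniformProb]

theorem uniformProb_le_expect_div {f : ι → ℝ} {a : ℝ} (hf : 0 ≤ f) (ha : 0 < a) :
    uniformProb (fun i => a < f i) ≤ (𝔼 i, f i) / a := by
  classical
  rw [uniformProb_eq_expect, Finset.expect_div]
  refine Finset.expect_le_expect fun i _ => ?_
  split_ifs with h
  · exact (one_le_div ha).2 h.le
  · exact div_nonneg (hf i) ha.le

theorem expect_sub_le_mul_uniformProb {f : ι → ℝ} {a b : ℝ} (ha : 0 ≤ a) (hf : ∀ i, f i ≤ b) :
    𝔼 i, f i - a ≤ b * uniformProb fun i => a ≤ f i := by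
  classical
  have h : 𝔼 i, (f i - b * if a ≤ f i then 1 else 0) ≤ a := by
    refine expect_le_of_forall_le ha fun i => ?_
    split_ifs with hi
    · linarith [hf i]
    · linarith
  rw [Finset.expect_sub_distrib, ← Finset.mul_expect, ← uniformProb_eq_expect] at h
  linarith

end Markov

section Chernoff

variable {I : Type*} [Fintype I] {p : ℕ}

theorem expect_prod_comp_eq_pow (g : I → ℝ) (p : ℕ) :
    𝔼 i : Fin p → I, ∏ j, g (i j) = (𝔼 i, g i) ^ p := by
  simp only [Fintype.expect_eq_sum_div_card, div_pow, Fintype.sum_pow, Fintype.card_fun,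
    Fintype.card_fin, Nat.cast_pow]

theorem expect_exp_le {f : I → ℝ} (hf : ∀ i, |f i| ≤ 1) (hmean : 𝔼 i, f i = 0) {a : ℝ}
    (ha : |a| ≤ 1) : 𝔼 i, Real.exp (a * f i) ≤ Real.exp (a ^ 2) := by
  have exp_le_quadratic (i : I) : Real.exp (a * f i) ≤ (1 + a ^ 2) + a * f i := by
    have hprod : |a * f i| ≤ 1 := by
      rw [abs_mul]
      exact mul_le_one₀ ha (abs_nonneg _) (hf i)
    have taylor := (abs_le.1 (Real.abs_exp_sub_one_sub_id_le hprod)).2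
    have hsq : (a * f i) ^ 2 ≤ a ^ 2 * 1 := by
      rw [mul_pow]
      gcongr
      exact (sq_le_one_iff_abs_le_one _).2 (hf i)
    linarith
  cases isEmpty_or_nonempty I
  · simpa using (Real.exp_pos _).le
  calc 𝔼 i, Real.exp (a * f i) ≤ 𝔼 i, ((1 + a ^ 2) + a * f i) :=
        Finset.expect_le_expect fun i _ => exp_le_quadratic i
    _ = a ^ 2 + 1 := by
        rw [Finset.expect_add_distrib, ← Finset.mul_expect, hmean, Fintype.expect_const, mul_zero,
          add_zero, add_comm]
    _ ≤ Real.exp (a ^ 2) := Real.add_one_le_exp _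

theorem uniformProb_le_sum_le_exp {f : I → ℝ} (hf : ∀ i, |f i| ≤ 1) (hmean : 𝔼 i, f i = 0)
    {α : ℝ} (h0 : 0 ≤ α) (h1 : α ≤ 1) (p : ℕ) :
    uniformProb (fun i : Fin p → I => p * α ≤ ∑ j, f (i j)) ≤ Real.exp (-(p * α ^ 2 / 4)) := by
  classical
  have exponential_markov (i : Fin p → I) : (if p * α ≤ ∑ j, f (i j) then (1 : ℝ) else 0) ≤
      Real.exp (-(α / 2 * (p * α))) * ∏ j, Real.exp (α / 2 * f (i j)) := by
    rw [← Real.exp_sum, ← Real.exp_add, ← Finset.mul_sum]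
    split_ifs with h
    · exact Real.one_le_exp (by nlinarith)
    · positivity
  calc uniformProb (fun i : Fin p → I => p * α ≤ ∑ j, f (i j))
      ≤ 𝔼 i : Fin p → I, Real.exp (-(α / 2 * (p * α))) * ∏ j, Real.exp (α / 2 * f (i j)) := by
        rw [uniformProb_eq_expect]
        exact Finset.expect_le_expect fun i _ => exponential_markov i
    _ = Real.exp (-(α / 2 * (p * α))) * (𝔼 i, Real.exp (α / 2 * f i)) ^ p := by
        rw [← Finset.mul_expect, expect_prod_comp_eq_pow fun i => Real.exp (α / 2 * f i)]
    _ ≤ Real.exp (-(α / 2 * (p * α))) * Real.exp ((α / 2) ^ 2) ^ p := by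
        have hα : |α / 2| ≤ 1 := abs_le.2 ⟨by linarith, by linarith⟩
        gcongr
        exact expect_exp_le hf hmean hα
    _ = Real.exp (-(p * α ^ 2 / 4)) := by
        rw [← Real.exp_nat_mul, ← Real.exp_add]
        congr 1
        ring

end Chernoff

section Tests

variable {Y Θ : Type*} [Fintype Y] {F : Θ → Y → ℝ} {α : ℝ} {p : ℕ}

/-- The test of a sample `y` against all statistics `F θ`: one of them has an empirical mean that
exceeds its mean under the uniform distribution by at least `α`. -/
def Exceeds (F : Θ → Y → ℝ) (α : ℝ) (y : Fin p → Y) : Prop :=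
  ∃ θ, p * α ≤ ∑ j, (F θ (y j) - 𝔼 v, F θ v)

theorem abs_sub_expect_le_one {I : Type*} [Fintype I] {f : I → ℝ} (h0 : 0 ≤ f)
    (h1 : ∀ i, f i ≤ 1) (i : I) : |f i - 𝔼 j, f j| ≤ 1 := by
  have mean_nonneg : 0 ≤ 𝔼 j, f j := Finset.expect_nonneg fun j _ => h0 j
  have mean_le_one : 𝔼 j, f j ≤ 1 := expect_le_of_forall_le zero_le_one h1
  have hi : 0 ≤ f i := h0 i
  exact abs_le.2 ⟨by linarith, by linarith [h1 i]⟩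

theorem expect_sub_expect_self {I : Type*} [Fintype I] (f : I → ℝ) : 𝔼 i, (f i - 𝔼 j, f j) = 0 := by
  cases isEmpty_or_nonempty I
  · simp
  · rw [Finset.expect_sub_distrib, Fintype.expect_const, sub_self]

theorem uniformProb_exceeds_le [Fintype Θ] (hF0 : ∀ θ, 0 ≤ F θ) (hF1 : ∀ θ c, F θ c ≤ 1)
    (h0 : 0 ≤ α) (h1 : α ≤ 1) (p : ℕ) :
    uniformProb (fun y : Fin p → Y => Exceeds F α y) ≤
      Fintype.card Θ * Real.exp (-(p * α ^ 2 / 4)) := by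
  calc uniformProb (fun y : Fin p → Y => Exceeds F α y)
      ≤ ∑ θ, uniformProb fun y : Fin p → Y => p * α ≤ ∑ j, (F θ (y j) - 𝔼 v, F θ v) :=
        uniformProb_exists_le _
    _ ≤ ∑ _θ : Θ, Real.exp (-(p * α ^ 2 / 4)) := Finset.sum_le_sum fun θ _ =>
        uniformProb_le_sum_le_exp (abs_sub_expect_le_one (hF0 θ) (hF1 θ))
          (expect_sub_expect_self (F θ)) h0 h1 p
    _ = Fintype.card Θ * Real.exp (-(p * α ^ 2 / 4)) := by
        rw [Finset.sum_const, Finset.card_univ, nsmul_eq_mul]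

theorem one_sub_exp_le_uniformProb_exceeds {I : Type*} [Fintype I] [Nonempty I] (s : I → Y)
    (hF0 : ∀ θ, 0 ≤ F θ) (hF1 : ∀ θ c, F θ c ≤ 1) (h0 : 0 ≤ α) (h1 : α ≤ 1) {θ : Θ}
    (hθ : 2 * α ≤ 𝔼 i, F θ (s i) - 𝔼 v, F θ v) (p : ℕ) :
    1 - Real.exp (-(p * α ^ 2 / 4)) ≤
      uniformProb fun i : Fin p → I => Exceeds F α fun j => s (i j) := by
  have lower_tail := uniformProb_le_sum_le_exp (f := fun i => -(F θ (s i) - 𝔼 j, F θ (s j)))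
    (fun i => by
      rw [abs_neg]
      exact abs_sub_expect_le_one (fun j => hF0 θ (s j)) (fun j => hF1 θ (s j)) i)
    (by rw [Finset.expect_neg_distrib, expect_sub_expect_self fun i => F θ (s i), neg_zero]) h0 h1 p
  have exceeds_or_lower_tail (i : Fin p → I) : True → (Exceeds F α fun j => s (i j)) ∨
      p * α ≤ ∑ j, -(F θ (s (i j)) - 𝔼 j, F θ (s j)) := by
    intro _
    by_contra! h
    have not_exceeds : ∑ j, (F θ (s (i j)) - 𝔼 v, F θ v) < p * α :=
      not_le.1 fun hle => h.1 ⟨θ, hle⟩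
    have hp := mul_le_mul_of_nonneg_left hθ p.cast_nonneg
    have hsum := h.2
    simp only [Finset.sum_neg_distrib, Finset.sum_sub_distrib, Finset.sum_const, Finset.card_univ,
      Fintype.card_fin, nsmul_eq_mul] at not_exceeds hsum
    linarith
  have hone := (uniformProb_mono exceeds_or_lower_tail).trans (uniformProb_or_le _ _)
  rw [uniformProb_true] at hone
  linarith

theorem uniformProb_exists_gap_sub_le {ι I : Type*} [Fintype ι] [Fintype I] [Nonempty I]
    [Fintype Θ] (s : ι → I → Y) (hF0 : ∀ θ, 0 ≤ F θ) (hF1 : ∀ θ c, F θ c ≤ 1) (h0 : 0 ≤ α)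
    (h1 : α ≤ 1) (p : ℕ) :
    (uniformProb fun k => ∃ θ, 2 * α ≤ 𝔼 i, F θ (s k i) - 𝔼 v, F θ v) -
        (1 + Fintype.card Θ) * Real.exp (-(p * α ^ 2 / 4)) ≤
      𝔼 k, (uniformProb fun i : Fin p → I => Exceeds F α fun j => s k (i j)) -
        uniformProb fun y : Fin p → Y => Exceeds F α y := by
  classical
  have false_alarm := uniformProb_exceeds_le hF0 hF1 h0 h1 p
  have detection : 𝔼 k, ((if ∃ θ, 2 * α ≤ 𝔼 i, F θ (s k i) - 𝔼 v, F θ v then 1 else 0) -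
        uniformProb fun i : Fin p → I => Exceeds F α fun j => s k (i j)) ≤
      Real.exp (-(p * α ^ 2 / 4)) := by
    refine expect_le_of_forall_le (Real.exp_pos _).le fun k => ?_
    split_ifs with h
    · obtain ⟨θ, hθ⟩ := h
      linarith [one_sub_exp_le_uniformProb_exceeds (s k) hF0 hF1 h0 h1 hθ p]
    · rw [zero_sub]
      exact (neg_nonpos.2 (uniformProb_nonneg _)).trans (Real.exp_pos _).le
  rw [Finset.expect_sub_distrib, ← uniformProb_eq_expect] at detection
  linarith

/-- The number of samples for which the test against at most `2 ^ M` statistics is reliable, if a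
mean gap of `2 / W` is to be detected. -/
def sampleSize {R : Type*} [CommSemiring R] (W M : R) : R := 4 * W ^ 2 * (M + 2 * W)

theorem exp_neg_sampleSize_le {W M N : ℕ} (hW : 0 < W) (hN : N ≤ 2 ^ M) :
    (1 + N) * Real.exp (-(sampleSize W M * (1 / W : ℝ) ^ 2 / 4)) ≤ 1 / W := by
  have : (0 : ℝ) < W := Nat.cast_pos.2 hW
  have exponent_eq : ((sampleSize W M : ℕ) : ℝ) * (1 / W : ℝ) ^ 2 / 4 = M + 2 * W := by
    simp only [sampleSize]
    push_cast
    field_simp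
  have card_le : (1 + N : ℝ) ≤ 2 * Real.exp M := by
    have two_pow_le : (2 : ℝ) ^ M ≤ Real.exp M := by
      rw [← Real.exp_one_pow]
      gcongr
      linarith [Real.add_one_le_exp (1 : ℝ)]
    have hNR : (N : ℝ) ≤ 2 ^ M := by exact_mod_cast hN
    linarith [one_le_pow₀ (one_le_two (α := ℝ)) (n := M)]
  rw [exponent_eq]
  calc (1 + N : ℝ) * Real.exp (-(M + 2 * W)) ≤ 2 * Real.exp M * Real.exp (-(M + 2 * W)) := by
        gcongr
    _ = 2 * (Real.exp (2 * W))⁻¹ := by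
        rw [mul_assoc, ← Real.exp_add, ← Real.exp_neg]
        congr 2
        ring
    _ ≤ 2 * (2 * W : ℝ)⁻¹ := by
        gcongr
        linarith [Real.add_one_le_exp (2 * W : ℝ)]
    _ = 1 / W := by field_simp

theorem exists_test {ι I : Type*} [Fintype ι] [Fintype I] [Nonempty I] [Fintype Θ]
    (s : ι → I → Y) (hF0 : ∀ θ, 0 ≤ F θ) (hF1 : ∀ θ c, F θ c ≤ 1) {W M : ℕ} (hW : 0 < W)
    (hM : Fintype.card Θ ≤ 2 ^ M)
    (hgap : 2 / W ≤ uniformProb fun k => ∃ θ, 2 / W ≤ 𝔼 i, F θ (s k i) - 𝔼 v, F θ v) :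
    ∃ P : (Fin (sampleSize W M) → Y) → Prop,
      1 / W ≤ 𝔼 k, (uniformProb fun i : Fin (sampleSize W M) → I => P fun j => s k (i j)) -
        uniformProb P := by
  have hα : 1 / (W : ℝ) ≤ 1 := div_le_one_of_le₀ (by exact_mod_cast hW) W.cast_nonneg
  have hle := uniformProb_exists_gap_sub_le s hF0 hF1 (by positivity) hα (sampleSize W M)
  have error_le := exp_neg_sampleSize_le hW hM
  have two_mul_eq : 2 * (1 / (W : ℝ)) = 2 / W := by ring
  refine ⟨Exceeds F (1 / W), le_trans ?_ hle⟩
  rw [two_mul_eq]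
  have : 2 / (W : ℝ) = 1 / W + 1 / W := by ring
  linarith

end Tests

/-! ### A distinguisher with few samples -/

section Tables

variable {X β : Type*} {N : ℕ}

open Classical in
/-- The domain of the partial function listed by the table `g`. -/
noncomputable def tableDomain [Fintype X] (g : Fin N → Option (X × β)) : Finset X :=
  {x | ∃ i b, g i = some (x, b)}

/-- A value at `x` of the partial function listed by the table `g`; arbitrary outside the domain. -/
noncomputable def tableValue [Nonempty β] (g : Fin N → Option (X × β)) (x : X) : β :=
  Classical.epsilon fun b => ∃ i, g i = some (x, b)

theorem exists_table [Fintype X] [Nonempty β] {H : Finset X} (hH : H.card ≤ N) (ω : X → β) :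
    ∃ g : Fin N → Option (X × β), tableDomain g = H ∧ ∀ x ∈ H, tableValue g x = ω x := by
  obtain ⟨f⟩ : Nonempty (H ↪ Fin N) :=
    Function.Embedding.nonempty_of_card_le (by simpa using hH)
  have partialInv_eq {i : Fin N} {x : H} : Function.partialInv f i = some x ↔ f x = i :=
    Function.Injective.isPartialInv f.injective x i
  let g : Fin N → Option (X × β) := fun i => (Function.partialInv f i).map fun x : H => (↑x, ω x)
  have listed_iff (x : X) (b : β) : (∃ i, g i = some (x, b)) ↔ x ∈ H ∧ b = ω x := by
    simp only [g, Option.map_eq_some_iff, partialInv_eq, Prod.mk.injEq]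
    constructor
    · rintro ⟨_, y, rfl, rfl, rfl⟩
      exact ⟨y.2, rfl⟩
    · rintro ⟨hx, rfl⟩
      exact ⟨f ⟨x, hx⟩, ⟨x, hx⟩, rfl, rfl, rfl⟩
  refine ⟨g, ?_, fun x hx => ?_⟩
  · ext x
    simp only [tableDomain, Finset.mem_filter, Finset.mem_univ, true_and]
    rw [exists_comm]
    simp [listed_iff]
  · exact ((listed_iff x _).1 (Classical.epsilon_spec
      (p := fun b => ∃ i, g i = some (x, b)) ⟨ω x, (listed_iff x _).2 ⟨hx, rfl⟩⟩)).2

end Tables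

theorem le_uniformProb_le_and_le {ι : Type*} [Fintype ι] {f g : ι → ℝ} {a b c : ℝ} (ha : 0 ≤ a)
    (hb : 0 < b) (hc : 0 < c) (hf : ∀ i, f i ≤ b) (hg : 0 ≤ g) :
    (𝔼 i, f i - a) / b - (𝔼 i, g i) / c ≤ uniformProb fun i => g i ≤ c ∧ a ≤ f i := by
  have reverse_markov := expect_sub_le_mul_uniformProb ha hf
  rw [mul_comm, ← div_le_iff₀ hb] at reverse_markov
  have split : uniformProb (fun i => a ≤ f i) ≤
      uniformProb fun i => (g i ≤ c ∧ a ≤ f i) ∨ c < g i :=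
    uniformProb_mono fun i hi => (le_or_gt (g i) c).imp (fun h => ⟨h, hi⟩) id
  linarith [uniformProb_or_le (fun i => g i ≤ c ∧ a ≤ f i) fun i => c < g i,
    uniformProb_le_expect_div hg hc]

section Parameters

variable {R : Type*} [CommSemiring R]

/-- The inverse of the parameter `ε` of the statistic, for `q` queries and a decoding gap of
`1 / G`. -/
def invEps (q G : R) : R := 8 * q * G

/-- The upper bound `1 + q / ε` of the statistic. -/
def statisticBound (q G : R) : R := 1 + q * invEps q G

/-- The inverse of the advantage of the distinguisher. -/
def invAdvantage (q G : R) : R := 8 * G * statisticBound q G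

/-- The size of the tables in which the learned points are listed. -/
def tableSize (q G : R) (m : ℕ) : R :=
  4 * G * statisticBound q G * (q * (1 + invEps q G ^ (2 * m)))

end Parameters

namespace FiniteCode

variable {X β K Kr Er Dr : Type*} [Fintype X] [Fintype β] [Fintype Er] [Fintype Dr]
  [DecidableEq X] {n : ℕ} (S : FiniteCode X β K Kr Er Dr n)

theorem statisticGap_le {ρ ε : ℝ} (h0 : 0 ≤ ρ) (h1 : ρ ≤ 1) (hε : 0 < ε) (r : Kr)
    (H : (X → β) → Finset X) (ω : X → β) : S.statisticGap ρ ε r H ω ≤ 1 + S.maxQueries / ε := by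
  have encodings_le : 𝔼 e, statistic (S.dec ((S.key r).output ω)) ρ ε (H ω) ω
      ((S.enc ((S.key r).output ω) e).output ω) ≤ 1 + S.maxQueries / ε :=
    expect_le_of_forall_le (by positivity) fun e =>
      statistic_le h0 h1 hε (S.card_dec_le _) (H ω) ω _
  have uniform_nonneg : 0 ≤ 𝔼 c, statistic (S.dec ((S.key r).output ω)) ρ ε (H ω) ω c :=
    Finset.expect_nonneg fun c _ => statistic_nonneg _ h0 h1 hε (H ω) ω c
  unfold statisticGap
  linarith

variable [Nonempty β]

/-- The statistic for a key and for the learned points listed by a table, scaled to `[0, 1]`. -/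
noncomputable def tableStatistic (ρ ε : ℝ) {N : ℕ} (θ : K × (Fin N → Option (X × β)))
    (c : List.Vector Bool n) : ℝ :=
  statistic (S.dec θ.1) ρ ε (tableDomain θ.2) (tableValue θ.2) c / (1 + S.maxQueries / ε)

theorem exists_tableStatistic_gap {ρ ε a : ℝ} {N : ℕ} (hε : 0 < ε) {r : Kr}
    {H : (X → β) → Finset X} {ω : X → β} (hN : (H ω).card ≤ N)
    (ha : a ≤ S.statisticGap ρ ε r H ω) :
    ∃ θ : K × (Fin N → Option (X × β)), a / (1 + S.maxQueries / ε) ≤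
      𝔼 e, S.tableStatistic ρ ε θ ((S.enc ((S.key r).output ω) e).output ω) -
        𝔼 c, S.tableStatistic ρ ε θ c := by
  obtain ⟨g, hdomain, hvalue⟩ := exists_table hN ω
  refine ⟨((S.key r).output ω, g), ?_⟩
  simp only [tableStatistic, hdomain, statistic_congr _ ρ ε hvalue, ← Finset.expect_div, ← sub_div]
  gcongr
  exact ha

variable [Fintype Kr] [Nonempty Kr] [Nonempty Er] {G m : ℕ} {ρ : ℝ}

theorem exists_frequent_gap (h0 : 0 ≤ ρ) (h1 : ρ ≤ 1)
    (hsse : SmallSetExpansion ρ m) (hm : m ≠ 0) (hG : 0 < G) (hq : 0 < S.maxQueries)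
    (hgap : 1 / G ≤ S.completeness ρ - 𝔼 y, S.falseAcceptance y) :
    ∃ H : Kr → (X → β) → Finset X,
      2 / (invAdvantage S.maxQueries G : ℕ) ≤ uniformProb fun i : Kr × (X → β) =>
        ((H i.1 i.2).card : ℝ) ≤ (tableSize S.maxQueries G m : ℕ) ∧
          1 / (4 * G) ≤ S.statisticGap ρ (1 / (invEps S.maxQueries G : ℕ)) i.1 (H i.1) i.2 := by
  set q := S.maxQueries
  have : (0 : ℝ) < G := Nat.cast_pos.2 hG
  have : (0 : ℝ) < q := Nat.cast_pos.2 hq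
  have hE : (0 : ℝ) < (invEps q G : ℕ) := by simp only [invEps]; positivity
  have hb : (0 : ℝ) < 1 + q / (1 / (invEps q G : ℕ)) := by positivity
  have hN : (0 : ℝ) < (tableSize q G m : ℕ) := by
    simp only [tableSize, statisticBound]
    positivity
  obtain ⟨H, hcard, hle⟩ := S.exists_completeness_le h0 h1 hsse hm (one_div_pos.2 hE)
  refine ⟨H, le_trans ?_ (le_uniformProb_le_and_le (by positivity) hb hN
    (fun i => S.statisticGap_le h0 h1 (one_div_pos.2 hE) i.1 (H i.1) i.2)
    fun i => Nat.cast_nonneg (H i.1 i.2).card)⟩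
  have mean_gap_ge : 3 / (4 * G) ≤
      𝔼 i : Kr × (X → β), S.statisticGap ρ (1 / (invEps q G : ℕ)) i.1 (H i.1) i.2 := by
    rw [← Finset.univ_product_univ, Finset.expect_product]
    have loss_eq : 2 * (q : ℝ) * (1 / (invEps q G : ℕ)) = 1 / G - 3 / (4 * G) := by
      simp only [invEps]
      push_cast
      field_simp
      norm_num
    linarith
  have mean_card_le : 𝔼 i : Kr × (X → β), ((H i.1 i.2).card : ℝ) ≤
      q * (1 + (invEps q G : ℕ) ^ (2 * m)) := by
    rw [← Finset.univ_product_univ, Finset.expect_product]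
    refine Finset.expect_le Finset.univ_nonempty fun r _ => (hcard r).trans_eq ?_
    rw [← pow_mul, one_div, inv_pow, div_inv_eq_mul]
    ring
  calc (2 : ℝ) / (invAdvantage q G : ℕ)
      = (3 / (4 * G) - 1 / (4 * G)) / (1 + q / (1 / (invEps q G : ℕ))) -
          q * (1 + (invEps q G : ℕ) ^ (2 * m)) / (tableSize q G m : ℕ) := by
        simp only [invAdvantage, tableSize, statisticBound]
        push_cast
        field_simp
        norm_num
    _ ≤ _ := by gcongr

theorem exists_distinguisher [Fintype K] (h0 : 0 ≤ ρ) (h1 : ρ ≤ 1)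
    (hsse : SmallSetExpansion ρ m) (hm : m ≠ 0) (hG : 0 < G) (hq : 0 < S.maxQueries) {M : ℕ}
    (hM : Fintype.card (K × (Fin (tableSize S.maxQueries G m) → Option (X × β))) ≤ 2 ^ M)
    (hgap : 1 / G ≤ S.completeness ρ - 𝔼 y, S.falseAcceptance y) :
    ∃ P : (Fin (sampleSize (invAdvantage S.maxQueries G) M) → List.Vector Bool n) → Prop,
      1 / (invAdvantage S.maxQueries G : ℕ) ≤
        𝔼 r, 𝔼 ω, (uniformProb fun e : Fin (sampleSize (invAdvantage S.maxQueries G) M) → Er =>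
          P fun j => (S.enc ((S.key r).output ω) (e j)).output ω) - uniformProb P := by
  obtain ⟨H, hfrequent⟩ := S.exists_frequent_gap h0 h1 hsse hm hG hq hgap
  have hW : 0 < invAdvantage S.maxQueries G := by
    simp only [invAdvantage, statisticBound]
    positivity
  have hε : (0 : ℝ) < 1 / (invEps S.maxQueries G : ℕ) := by
    simp only [invEps]
    positivity
  have scaled_gap : 1 / (4 * G) / (1 + S.maxQueries / (1 / (invEps S.maxQueries G : ℕ) : ℝ)) =
      2 / (invAdvantage S.maxQueries G : ℕ) := by
    simp only [invAdvantage, statisticBound]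
    push_cast
    field_simp
    norm_num
  have hF0 (θ : K × (Fin (tableSize S.maxQueries G m) → Option (X × β))) :
      0 ≤ S.tableStatistic ρ (1 / (invEps S.maxQueries G : ℕ)) θ := fun c =>
    div_nonneg (statistic_nonneg _ h0 h1 hε _ _ c) (by positivity)
  have hF1 (θ : K × (Fin (tableSize S.maxQueries G m) → Option (X × β)))
      (c : List.Vector Bool n) : S.tableStatistic ρ (1 / (invEps S.maxQueries G : ℕ)) θ c ≤ 1 :=
    div_le_one_of_le₀ (statistic_le h0 h1 hε (S.card_dec_le _) _ _ c) (by positivity)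
  obtain ⟨P, hP⟩ := exists_test
    (fun (i : Kr × (X → β)) e => (S.enc ((S.key i.1).output i.2) e).output i.2) hF0 hF1 hW hM
    (hfrequent.trans <| uniformProb_mono fun i hi => by
      rw [← scaled_gap]
      exact S.exists_tableStatistic_gap hε (Nat.cast_le.1 hi.1) hi.2)
  refine ⟨P, ?_⟩
  rwa [← Finset.univ_product_univ, Finset.expect_product] at hP

end FiniteCode

/-! ### Oracle machines as query algorithms -/

namespace QueryAlgorithm

variable {X Q β Y α γ : Type*}

/-- The algorithm `A` with its output transformed by `f`. -/
def map (f : α → γ) (A : QueryAlgorithm X β α) : QueryAlgorithm X β γ where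
  output ω := f (A.output ω)
  queries := A.queries
  isLocal ω ω' h := ⟨(A.isLocal ω ω' h).1, congrArg f (A.isLocal ω ω' h).2⟩

/-- The algorithm `A`, all of whose outputs have length `n`, with a vector as its output. -/
def toVector {n : ℕ} (A : QueryAlgorithm X β (List α)) (hA : ∀ ω, (A.output ω).length = n) :
    QueryAlgorithm X β (List.Vector α n) where
  output ω := ⟨A.output ω, hA ω⟩
  queries := A.queries
  isLocal ω ω' h := ⟨(A.isLocal ω ω' h).1, Subtype.ext (A.isLocal ω ω' h).2⟩

/-- The algorithm `A` whose oracle is implemented by the algorithms `B`. -/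
def comp [DecidableEq X] (A : QueryAlgorithm Q Y α) (B : Q → QueryAlgorithm X β Y) :
    QueryAlgorithm X β α where
  output ω := A.output fun q => (B q).output ω
  queries ω := (A.queries fun q => (B q).output ω).biUnion fun q => (B q).queries ω
  isLocal ω ω' h := by
    have hB : ∀ q ∈ A.queries fun q => (B q).output ω,
        (B q).queries ω' = (B q).queries ω ∧ (B q).output ω' = (B q).output ω := fun q hq =>
      (B q).isLocal ω ω' fun x hx => h x (Finset.mem_biUnion.2 ⟨q, hq, hx⟩)
    have hA := A.isLocal _ (fun q => (B q).output ω') fun q hq => (hB q hq).2.symm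
    exact ⟨by rw [hA.1]; exact Finset.biUnion_congr rfl fun q hq => (hB q hq).1, hA.2⟩

end QueryAlgorithm

namespace BitTape

/-- The number of listed cells apart from the scanned one. -/
def size (t : BitTape) : ℕ := t.left.length + t.right.length

theorem length_bitsOf_le : ∀ l : List (Option Bool), (bitsOf l).length ≤ l.length
  | [] => by simp [bitsOf]
  | none :: l => by simp [bitsOf]
  | some b :: l => by simpa [bitsOf] using length_bitsOf_le l

theorem length_contents_le (t : BitTape) : t.contents.length ≤ t.size + 1 := by
  have hle := length_bitsOf_le (t.head :: t.right)
  simp only [List.length_cons] at hle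
  simp only [contents, size]
  omega

theorem size_update_le (t : BitTape) (s : Option Bool) (m : HeadMove) :
    (t.update s m).size ≤ t.size + 1 := by
  cases m <;> simp only [update, size, List.length_cons, List.length_tail] <;> omega

end BitTape

namespace OracleTM

variable {a : ℕ} {M : OracleTM a}

theorem size_tape_step_le (O : List Bool → List Bool) (coin : Bool) (c : Cfg M)
    {i : TapeName a M.workTapes} (hi : i ≠ .answer) :
    ((M.step O coin c).tape i).size ≤ (c.tape i).size + 1 := by
  unfold step
  split
  · exact Nat.le_succ _
  · split
    · exact Nat.le_succ _
    · cases i with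
      | answer => exact absurd rfl hi
      | query => exact Nat.zero_le _
      | _ => exact Nat.le_succ _
    · exact BitTape.size_update_le _ _ _

theorem size_tape_foldl_step_le (O : List Bool → List Bool) {i : TapeName a M.workTapes}
    (hi : i ≠ .answer) (r : List Bool) (c : Cfg M) :
    ((r.foldl (fun c coin => M.step O coin c) c).tape i).size ≤ (c.tape i).size + r.length := by
  induction r generalizing c with
  | nil => exact le_rfl
  | cons coin r ih =>
    have hstep := size_tape_step_le O coin c hi
    have hrest := ih (M.step O coin c)
    simp only [List.foldl_cons, List.length_cons]
    omega

theorem length_result_le (O : List Bool → List Bool) (x : Fin a → List Bool) (r : List Bool) :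
    (M.result O x r).length ≤ r.length + 1 := by
  have hsize := size_tape_foldl_step_le O (i := .output) (by simp) r (M.initial x)
  have initial_size : ((M.initial x).tape .output).size = 0 := rfl
  rw [initial_size, zero_add] at hsize
  exact (BitTape.length_contents_le _).trans (Nat.succ_le_succ hsize)

variable (M) in
/-- The query, if any, that is made in the next step. -/
def asked (c : Cfg M) (coin : Bool) : Finset (List Bool) :=
  match c.state with
  | none => ∅
  | some s =>
    match M.trans s (fun i => (c.tape i).head) coin with
    | .ask _ => {(c.tape .query).contents}
    | _ => ∅

variable (M) in
/-- The queries made from the configuration `c` on, with the random bits `r`. -/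
def askedFrom (O : List Bool → List Bool) : Cfg M → List Bool → Finset (List Bool)
  | _, [] => ∅
  | c, coin :: r => M.asked c coin ∪ askedFrom O (M.step O coin c) r

theorem step_congr {O O' : List Bool → List Bool} {c : Cfg M} {coin : Bool}
    (h : ∀ q ∈ M.asked c coin, O q = O' q) : M.step O coin c = M.step O' coin c := by
  simp only [asked] at h
  simp only [step]
  cases hs : c.state with
  | none => rfl
  | some s =>
    simp only [hs] at h ⊢
    cases ht : M.trans s (fun i => (c.tape i).head) coin with
    | halt => rfl
    | act s' wr => rfl
    | ask s' =>
      simp only [ht] at h ⊢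
      rw [h _ (Finset.mem_singleton_self _)]

theorem askedFrom_congr {O O' : List Bool → List Bool} {r : List Bool} {c : Cfg M}
    (h : ∀ q ∈ M.askedFrom O c r, O q = O' q) :
    M.askedFrom O' c r = M.askedFrom O c r ∧
      r.foldl (fun c coin => M.step O' coin c) c = r.foldl (fun c coin => M.step O coin c) c := by
  induction r generalizing c with
  | nil => exact ⟨rfl, rfl⟩
  | cons coin r ih =>
    have step_eq : M.step O' coin c = M.step O coin c :=
      (step_congr fun q hq => h q (Finset.mem_union_left _ hq)).symm
    have hrest := ih (c := M.step O coin c) fun q hq => h q (Finset.mem_union_right _ hq)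
    simp only [askedFrom, List.foldl_cons, step_eq]
    exact ⟨by rw [hrest.1], hrest.2⟩

theorem card_asked_le_one (c : Cfg M) (coin : Bool) : (M.asked c coin).card ≤ 1 := by
  unfold asked
  split
  · simp
  · split <;> simp

theorem card_askedFrom_le (O : List Bool → List Bool) (c : Cfg M) (r : List Bool) :
    (M.askedFrom O c r).card ≤ r.length := by
  induction r generalizing c with
  | nil => simp [askedFrom]
  | cons coin r ih =>
    have hunion := Finset.card_union_le (M.asked c coin) (M.askedFrom O (M.step O coin c) r)
    simp only [askedFrom, List.length_cons]
    linarith [card_asked_le_one c coin, ih (M.step O coin c)]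

theorem length_le_of_mem_asked {c : Cfg M} {coin : Bool} {q : List Bool}
    (h : q ∈ M.asked c coin) : q.length ≤ (c.tape .query).size + 1 := by
  unfold asked at h
  split at h
  · simp at h
  · split at h
    · rw [Finset.mem_singleton.1 h]
      exact BitTape.length_contents_le _
    · simp at h

theorem length_le_of_mem_askedFrom {O : List Bool → List Bool} {q : List Bool} {c : Cfg M}
    {r : List Bool} (h : q ∈ M.askedFrom O c r) :
    q.length ≤ (c.tape .query).size + r.length := by
  induction r generalizing c with
  | nil => simp [askedFrom] at h
  | cons coin r ih =>
    rw [List.length_cons]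
    rcases Finset.mem_union.1 h with hnow | hlater
    · linarith [length_le_of_mem_asked hnow]
    · linarith [ih hlater, size_tape_step_le O coin c (i := .query) (by simp)]

/-- The run of `M` on input `x` with the random bits `r`, as an algorithm that queries the
oracle. -/
def run (M : OracleTM a) (x : Fin a → List Bool) (r : List Bool) :
    QueryAlgorithm (List Bool) (List Bool) (List Bool) where
  output O := M.result O x r
  queries O := M.askedFrom O (M.initial x) r
  isLocal _ _ h :=
    have hcongr := askedFrom_congr h
    ⟨hcongr.1, congrArg (fun c : Cfg M => (c.tape .output).contents) hcongr.2⟩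

theorem card_queries_run_le (x : Fin a → List Bool) (r : List Bool) (O : List Bool → List Bool) :
    ((M.run x r).queries O).card ≤ r.length :=
  card_askedFrom_le O _ r

theorem length_le_of_mem_queries_run {x : Fin a → List Bool} {r : List Bool}
    {O : List Bool → List Bool} {q : List Bool} (h : q ∈ (M.run x r).queries O) :
    q.length ≤ r.length :=
  (length_le_of_mem_askedFrom h).trans_eq (zero_add _)

end OracleTM

theorem monotone_eval_nat (p : Polynomial ℕ) : Monotone fun k : ℕ => p.eval k := by
  intro k l h
  simp only [Polynomial.eval_eq_sum_range]
  gcongr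

namespace CryptoOracle

/-- The algorithm that reads one bit of the secret function. -/
def readBit (z : List Bool) : QueryAlgorithm (List Bool) Bool (List Bool) where
  output R := bitOracle R z
  queries _ := {z}
  isLocal _ _ h := ⟨rfl, congrArg (fun b => [b]) (h z (Finset.mem_singleton_self z)).symm⟩

variable (B : CryptoOracle)

/-- The computation of `B^R` on the query `q`, as an algorithm that queries `R`. -/
def answer (q : List Bool) : QueryAlgorithm (List Bool) Bool (List Bool) :=
  (B.alg.machine.run ![q] (List.replicate (B.alg.time.eval q.length) false)).comp readBit

theorem card_queries_answer_le (q : List Bool) (R : List Bool → Bool) :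
    ((B.answer q).queries R).card ≤ B.alg.time.eval q.length := by
  refine (Finset.card_biUnion_le_card_mul _ _ 1 fun z _ => (Finset.card_singleton z).le).trans ?_
  rw [mul_one]
  exact (OracleTM.card_queries_run_le _ _ _).trans_eq List.length_replicate

theorem length_le_of_mem_queries_answer {q z : List Bool} {R : List Bool → Bool}
    (h : z ∈ (B.answer q).queries R) : z.length ≤ B.alg.time.eval q.length := by
  obtain ⟨z', hz', hz⟩ := Finset.mem_biUnion.1 h
  rw [Finset.mem_singleton.1 hz]
  simpa using OracleTM.length_le_of_mem_queries_run hz'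

/-- A run of the machine `M` relative to `B^R`, as an algorithm that queries `R`. -/
def run {a : ℕ} (M : OracleTM a) (x : Fin a → List Bool) (r : List Bool) :
    QueryAlgorithm (List Bool) Bool (List Bool) :=
  (M.run x r).comp B.answer

variable {a : ℕ} {M : OracleTM a} {x : Fin a → List Bool} {r : List Bool}

theorem card_queries_run_le (R : List Bool → Bool) :
    ((B.run M x r).queries R).card ≤ r.length * B.alg.time.eval r.length := by
  refine (Finset.card_biUnion_le_card_mul _ _ (B.alg.time.eval r.length) fun q hq => ?_).trans ?_
  · exact (B.card_queries_answer_le q R).trans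
      (monotone_eval_nat _ (OracleTM.length_le_of_mem_queries_run hq))
  · gcongr
    exact OracleTM.card_queries_run_le x r _

theorem length_le_of_mem_queries_run {z : List Bool} {R : List Bool → Bool}
    (h : z ∈ (B.run M x r).queries R) : z.length ≤ B.alg.time.eval r.length := by
  obtain ⟨q, hq, hz⟩ := Finset.mem_biUnion.1 h
  exact (B.length_le_of_mem_queries_answer hz).trans
    (monotone_eval_nat _ (OracleTM.length_le_of_mem_queries_run hq))

end CryptoOracle

/-! ### Games as averages over a finite random function -/

section UniformBits

variable {α β V : Type} [Fintype V] [Nonempty V]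

theorem toReal_uniform_bind (g : V → PMF α) (a : α) :
    ((PMF.uniformOfFintype V).bind g a).toReal = 𝔼 v, (g v a).toReal := by
  rw [PMF.bind_apply, tsum_fintype, ENNReal.toReal_sum fun v _ =>
    ENNReal.mul_ne_top (PMF.apply_ne_top _ _) (PMF.apply_ne_top _ _),
    Fintype.expect_eq_sum_div_card, Finset.sum_div]
  refine Finset.sum_congr rfl fun v _ => ?_
  rw [ENNReal.toReal_mul, PMF.uniformOfFintype_apply, ENNReal.toReal_inv, ENNReal.toReal_natCast]
  ring

theorem toReal_map_uniform_bind (s : V → β) (g : β → PMF α) (a : α) :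
    (((PMF.uniformOfFintype V).map s).bind g a).toReal = 𝔼 v, (g (s v) a).toReal := by
  rw [PMF.bind_map, toReal_uniform_bind]
  rfl

theorem toReal_map_uniform (s : V → α) (a : α) :
    ((PMF.uniformOfFintype V).map s a).toReal = uniformProb fun v => s v = a := by
  classical
  rw [← PMF.bind_pure_comp, toReal_uniform_bind, uniformProb_eq_expect]
  refine Finset.expect_congr rfl fun v _ => ?_
  simp only [Function.comp_apply, PMF.pure_apply, eq_comm]
  split_ifs <;> simp

end UniformBits

section Channel

variable {α : Type} (ρ : unitInterval)

theorem toReal_flipBit_bind (g : Bool → PMF α) (a : α) :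
    ((flipBit ρ).bind g a).toReal =
      (1 - ρ) / 2 * (g true a).toReal + (1 + ρ) / 2 * (g false a).toReal := by
  have h0 := ρ.2.1
  have h1 := ρ.2.2
  rw [PMF.bind_apply, tsum_fintype, Fintype.sum_bool, ENNReal.toReal_add
    (ENNReal.mul_ne_top (PMF.apply_ne_top _ _) (PMF.apply_ne_top _ _))
    (ENNReal.mul_ne_top (PMF.apply_ne_top _ _) (PMF.apply_ne_top _ _)),
    ENNReal.toReal_mul, ENNReal.toReal_mul]
  simp only [flipBit, PMF.ofFintype_apply, if_true, Bool.false_eq_true, if_false]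
  rw [ENNReal.toReal_ofReal (by linarith), ENNReal.toReal_ofReal (by linarith)]

theorem noise_cons_bind (b : Bool) (x : List Bool) (g : List Bool → PMF α) :
    (noise ρ (b :: x)).bind g =
      (flipBit ρ).bind fun e => (noise ρ x).bind fun y => g (xor b e :: y) := by
  change PMF.bind (PMF.bind _ fun e => PMF.bind _ fun y => PMF.pure _) g = _
  simp only [PMF.bind_bind, PMF.pure_bind]

theorem toReal_noise_bind (a : α) : ∀ {n : ℕ} (c : List.Vector Bool n) (g : List Bool → PMF α),
    ((noise ρ c.toList).bind g a).toReal =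
      noiseOp ρ (fun y : List.Vector Bool n => (g y.toList a).toReal) c
  | 0, c, g => by
    rw [noiseOp_of_length_zero, c.eq_nil]
    simp [noise]
  | n + 1, c, g => by
    obtain ⟨b, v, rfl⟩ := c.exists_eq_cons
    let f (y : List.Vector Bool (n + 1)) := (g y.toList a).toReal
    have slice_noiseOp_f := congrFun (slice_noiseOp ρ b f) v
    rw [List.Vector.toList_cons, noise_cons_bind, toReal_flipBit_bind,
      toReal_noise_bind a v, toReal_noise_bind a v, Bool.xor_true, Bool.xor_false]
    exact (add_comm _ _).trans slice_noiseOp_f.symm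

end Channel

section RandomFunction

variable {α : Type}

instance : IsProbabilityMeasure randomFunction := by
  unfold randomFunction
  infer_instance

theorem prob_eq_expect {game : (List Bool → Bool) → PMF α} {a : α} {s : Finset (List Bool)}
    {G : (s → Bool) → ℝ} (hG : ∀ R, (game R a).toReal = G (s.restrict R)) :
    prob game {a} = 𝔼 ω, G ω := by
  have apply_eq (R : List Bool → Bool) : game R a = ENNReal.ofReal (G (s.restrict R)) := by
    rw [← hG, ENNReal.ofReal_toReal (PMF.apply_ne_top _ _)]
  have measurable_apply : Measurable fun R => game R a := by
    simp only [apply_eq]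
    exact (measurable_of_countable fun ω => ENNReal.ofReal (G ω)).comp
      (Finset.measurable_restrict s)
  have prob_singleton (ω : s → Bool) :
      (Measure.pi fun _ : s => (PMF.uniformOfFintype Bool).toMeasure).real {ω} =
        (Fintype.card (s → Bool) : ℝ)⁻¹ := by
    simp [Measure.real]
  simp only [prob, PMF.toOuterMeasure_apply_singleton]
  rw [← integral_toReal measurable_apply.aemeasurable
    (.of_forall fun R => (PMF.apply_ne_top _ _).lt_top)]
  simp only [hG, randomFunction]
  rw [integral_restrict_infinitePi
    (μ := fun _ : List Bool => (PMF.uniformOfFintype Bool).toMeasure)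
    (measurable_of_countable G).aestronglyMeasurable,
    integral_fintype .of_finite, Fintype.expect_eq_sum_div_card, Finset.sum_div]
  refine Finset.sum_congr rfl fun ω _ => ?_
  rw [prob_singleton, smul_eq_mul, inv_mul_eq_div]

theorem prob_add_prob_le_one (game : (List Bool → Bool) → PMF α) {a b : α} (hab : a ≠ b) :
    prob game {a} + prob game {b} ≤ 1 := by
  have lintegral_le (c : α) : ∫⁻ R, game R c ∂randomFunction ≤ 1 :=
    (lintegral_mono fun R => PMF.coe_le_one _ _).trans_eq (by simp)
  have ne_top (c : α) := ((lintegral_le c).trans_lt ENNReal.one_lt_top).ne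
  classical
  have add_le (R : List Bool → Bool) : game R a + game R b ≤ 1 := by
    rw [← Finset.sum_pair hab, ← PMF.tsum_coe (game R)]
    exact ENNReal.sum_le_tsum _
  simp only [prob, PMF.toOuterMeasure_apply_singleton]
  rw [← ENNReal.toReal_add (ne_top a) (ne_top b), ← ENNReal.toReal_one]
  refine ENNReal.toReal_mono ENNReal.one_ne_top ((le_lintegral_add _ _).trans ?_)
  exact (lintegral_mono add_le).trans_eq (by simp)

end RandomFunction

section Restriction

variable {X β α : Type*} [Inhabited β] {s : Finset X}

/-- The extension by a default value of a function on a finite set. -/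
noncomputable def extendDefault (ω : s → β) : X → β :=
  Function.extend Subtype.val ω fun _ => default

theorem extendDefault_of_mem (ω : s → β) {x : X} (hx : x ∈ s) : extendDefault ω x = ω ⟨x, hx⟩ :=
  Subtype.val_injective.extend_apply ω _ ⟨x, hx⟩

namespace QueryAlgorithm

variable [DecidableEq X] (A : QueryAlgorithm X β α) (hA : ∀ ω, A.queries ω ⊆ s)

/-- An algorithm all of whose queries are in `s`, as an algorithm that queries a function on `s`. -/
noncomputable def restrict : QueryAlgorithm s β α where
  output ω := A.output (extendDefault ω)
  queries ω := (A.queries (extendDefault ω)).subtype (· ∈ s)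
  isLocal ω ω' h := by
    have hlocal := A.isLocal (extendDefault ω) (extendDefault ω') fun x hx => by
      rw [extendDefault_of_mem _ (hA _ hx), extendDefault_of_mem _ (hA _ hx)]
      exact h _ (Finset.mem_subtype.2 hx)
    exact ⟨by rw [hlocal.1], hlocal.2⟩

theorem output_restrict (ω : X → β) : (A.restrict hA).output (s.restrict ω) = A.output ω :=
  (A.isLocal _ _ fun _ hx => (extendDefault_of_mem (s.restrict ω) (hA _ hx)).symm).2

theorem card_queries_restrict_le (ω : s → β) :
    ((A.restrict hA).queries ω).card ≤ (A.queries (extendDefault ω)).card :=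
  (Finset.card_subtype _ _).trans_le (Finset.card_filter_le _ _)

end QueryAlgorithm

end Restriction

/-- The strings of length at most `L`. -/
def shortStrings (L : ℕ) : Finset (List Bool) :=
  (Finset.range (L + 1)).biUnion fun i =>
    Finset.univ.image (List.Vector.toList : List.Vector Bool i → List Bool)

theorem mem_shortStrings {L : ℕ} {x : List Bool} : x ∈ shortStrings L ↔ x.length ≤ L := by
  simp only [shortStrings, Finset.mem_biUnion, Finset.mem_range, Finset.mem_image, Finset.mem_univ,
    true_and, Nat.lt_succ_iff]
  constructor
  · rintro ⟨i, hi, v, rfl⟩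
    rwa [v.toList_length]
  · exact fun h => ⟨x.length, h, ⟨x, rfl⟩, rfl⟩

theorem card_shortStrings_le (L : ℕ) : (shortStrings L).card ≤ 2 ^ (L + 1) :=
  calc (shortStrings L).card ≤ ∑ i ∈ Finset.range (L + 1), 2 ^ i :=
        Finset.card_biUnion_le.trans <| Finset.sum_le_sum fun i _ =>
          Finset.card_image_le.trans_eq (by simp)
    _ ≤ 2 ^ (L + 1) := by
        rw [Nat.geomSum_eq le_rfl]
        simp

/-! ### Codes relative to a crypto oracle as codes relative to a finite random function -/

namespace CryptoOracle

variable (B : CryptoOracle) {a u : ℕ} (M : OracleTM a) (x : Fin a → List Bool) {r : List Bool}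

theorem queries_run_subset (hr : r.length ≤ u) (R : List Bool → Bool) :
    (B.run M x r).queries R ⊆ shortStrings (B.alg.time.eval u) := fun _ hz =>
  mem_shortStrings.2 ((B.length_le_of_mem_queries_run hz).trans (monotone_eval_nat _ hr))

/-- A run of length at most `u` of the machine `M` relative to `B^R`, as an algorithm that queries
the restriction of `R` to the strings that can be queried. -/
noncomputable def runShort (hr : r.length ≤ u) :
    QueryAlgorithm (shortStrings (B.alg.time.eval u)) Bool (List Bool) :=
  (B.run M x r).restrict (B.queries_run_subset M x hr)

theorem output_runShort (hr : r.length ≤ u) (R : List Bool → Bool) :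
    (B.runShort M x hr).output ((shortStrings (B.alg.time.eval u)).restrict R) =
      M.result (B.fn R) x r :=
  QueryAlgorithm.output_restrict _ _ R

theorem card_queries_runShort_le (hr : r.length ≤ u)
    (ω : shortStrings (B.alg.time.eval u) → Bool) :
    ((B.runShort M x hr).queries ω).card ≤ u * B.alg.time.eval u :=
  (QueryAlgorithm.card_queries_restrict_le _ _ ω).trans <|
    (B.card_queries_run_le _).trans (Nat.mul_le_mul hr (monotone_eval_nat _ hr))

end CryptoOracle

namespace PPTMachine

variable {a : ℕ} {𝒪 : Set (List Bool → List Bool)} (M : PPTMachine a 𝒪)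

theorem dist_eq (O : List Bool → List Bool) {x : Fin a → List Bool} {t : ℕ}
    (ht : M.time.eval (∑ i, (x i).length) = t) :
    M.dist O x = (PMF.uniformOfFintype (List.Vector Bool t)).map
      fun r => M.machine.result O x r.toList := by
  subst ht
  rfl

theorem result_mem_support (O : List Bool → List Bool) {x : Fin a → List Bool} {t : ℕ}
    (ht : M.time.eval (∑ i, (x i).length) = t) (r : List.Vector Bool t) :
    M.machine.result O x r.toList ∈ (M.dist O x).support := by
  rw [M.dist_eq O ht, PMF.support_map, PMF.support_uniformOfFintype]
  exact ⟨r, trivial, rfl⟩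

theorem length_le_of_mem_support {O : List Bool → List Bool} {x : Fin a → List Bool}
    {y : List Bool} (h : y ∈ (M.dist O x).support) :
    y.length ≤ M.time.eval (∑ i, (x i).length) + 1 := by
  rw [M.dist_eq O rfl, PMF.support_map] at h
  obtain ⟨r, -, rfl⟩ := h
  exact (OracleTM.length_result_le _ _ _).trans_eq (by rw [r.toList_length])

end PPTMachine

namespace OracleCode

variable {B : CryptoOracle} (C : OracleCode B) (κ : ℕ)

/-- The number of random bits of the key generation. -/
def keyTime : ℕ := C.keyGen.time.eval κ

/-- The number of random bits of the encoder. -/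
def encTime : ℕ := C.enc.time.eval (κ + C.keyLen κ + C.msgLen κ)

/-- The number of random bits of the decoder. -/
def decTime : ℕ := C.dec.time.eval (κ + C.keyLen κ + C.codeLen κ)

/-- The number `u` bounds the running times of the algorithms. -/
def TimeAtMost (u : ℕ) : Prop := C.keyTime κ ≤ u ∧ C.encTime κ ≤ u ∧ C.decTime κ ≤ u

variable {κ}

theorem keyGen_time_eq :
    C.keyGen.time.eval (∑ i, ((![unary κ] : Fin 1 → List Bool) i).length) = C.keyTime κ := by
  simp [keyTime, unary]

theorem enc_time_eq {sk m : List Bool} (hsk : sk.length = C.keyLen κ)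
    (hm : m.length = C.msgLen κ) :
    C.enc.time.eval (∑ i, ((![unary κ, sk, m] : Fin 3 → List Bool) i).length) = C.encTime κ := by
  simp [encTime, unary, Fin.sum_univ_three, hsk, hm]

theorem dec_time_eq {sk c : List Bool} (hsk : sk.length = C.keyLen κ)
    (hc : c.length = C.codeLen κ) :
    C.dec.time.eval (∑ i, ((![unary κ, sk, c] : Fin 3 → List Bool) i).length) = C.decTime κ := by
  simp [decTime, unary, Fin.sum_univ_three, hsk, hc]

theorem keyLen_le : C.keyLen κ ≤ C.keyTime κ + 1 := by
  let O := B.fn fun _ => false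
  obtain ⟨sk, hsk⟩ := (C.keyGen.dist O ![unary κ]).support_nonempty
  rw [← C.keyGen_length O ⟨_, rfl⟩ κ sk hsk, ← C.keyGen_time_eq]
  exact C.keyGen.length_le_of_mem_support hsk

theorem codeLen_le : C.codeLen κ ≤ C.encTime κ + 1 := by
  let O := B.fn fun _ => false
  let sk := List.replicate (C.keyLen κ) false
  let m := List.replicate (C.msgLen κ) false
  have hsk : sk.length = C.keyLen κ := List.length_replicate
  have hm : m.length = C.msgLen κ := List.length_replicate
  obtain ⟨c, hc⟩ := (C.enc.dist O ![unary κ, sk, m]).support_nonempty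
  rw [← C.enc_length O ⟨_, rfl⟩ κ sk m hsk hm c hc, ← C.enc_time_eq hsk hm]
  exact C.enc.length_le_of_mem_support hc

theorem exists_timeAtMost_eval : ∃ U : Polynomial ℕ, ∀ κ, C.TimeAtMost κ (U.eval κ) := by
  obtain ⟨pm, hpm⟩ := C.msgLen_poly
  let Pe : Polynomial ℕ := C.enc.time.comp (.X + (C.keyGen.time + 1) + pm)
  let Pd : Polynomial ℕ := C.dec.time.comp (.X + (C.keyGen.time + 1) + (Pe + 1))
  refine ⟨C.keyGen.time + Pe + Pd, fun κ => ?_⟩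
  have encTime_le : C.encTime κ ≤ Pe.eval κ := by
    simp only [Pe, Polynomial.eval_comp, Polynomial.eval_add, Polynomial.eval_X,
      Polynomial.eval_one]
    exact monotone_eval_nat _ (by gcongr; exacts [C.keyLen_le, hpm κ])
  have decTime_le : C.decTime κ ≤ Pd.eval κ := by
    simp only [Pd, Polynomial.eval_comp, Polynomial.eval_add, Polynomial.eval_X,
      Polynomial.eval_one]
    exact monotone_eval_nat _ (by gcongr; exacts [C.keyLen_le, C.codeLen_le.trans (by gcongr)])
  simp only [TimeAtMost, keyTime, Polynomial.eval_add]
  omega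

variable {u : ℕ} (hu : C.TimeAtMost κ u) (m : List.Vector Bool (C.msgLen κ))

/-- The code for the fixed message `m`, as a code relative to the restriction of the random function
to the strings that can be queried. -/
noncomputable def toFiniteCode : FiniteCode (shortStrings (B.alg.time.eval u)) Bool
    (List.Vector Bool (C.keyLen κ)) (List.Vector Bool (C.keyTime κ))
    (List.Vector Bool (C.encTime κ)) (List.Vector Bool (C.decTime κ)) (C.codeLen κ) where
  key r := (B.runShort C.keyGen.machine ![unary κ] (r.toList_length.trans_le hu.1)).toVector
    fun _ => C.keyGen_length _ ⟨_, rfl⟩ κ _ (C.keyGen.result_mem_support _ C.keyGen_time_eq r)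
  enc k e := (B.runShort C.enc.machine ![unary κ, k.toList, m.toList]
    (e.toList_length.trans_le hu.2.1)).toVector
    fun _ => C.enc_length _ ⟨_, rfl⟩ κ _ _ k.toList_length m.toList_length _
      (C.enc.result_mem_support _ (C.enc_time_eq k.toList_length m.toList_length) e)
  dec k d y := (B.runShort C.dec.machine ![unary κ, k.toList, y.toList]
    (d.toList_length.trans_le hu.2.2)).map fun z => decide (readMessage z = some m.toList)
  maxQueries := u * B.alg.time.eval u + 1
  card_key_le r ω := Nat.le_succ_of_le <|
    B.card_queries_runShort_le _ _ (r.toList_length.trans_le hu.1) ω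
  card_enc_le _ e ω := Nat.le_succ_of_le <|
    B.card_queries_runShort_le _ _ (e.toList_length.trans_le hu.2.1) ω
  card_dec_le _ d _ ω := Nat.le_succ_of_le <|
    B.card_queries_runShort_le _ _ (d.toList_length.trans_le hu.2.2) ω

section Games

variable (R : List Bool → Bool)

theorem sampleKey_eq : C.sampleKey R κ =
    (PMF.uniformOfFintype (List.Vector Bool (C.keyTime κ))).map fun r =>
      (((C.toFiniteCode hu m).key r).output (Finset.restrict _ R)).toList := by
  rw [sampleKey, C.keyGen.dist_eq _ C.keyGen_time_eq]
  exact congrArg (PMF.map · _) <| funext fun r =>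
    (B.output_runShort _ _ (r.toList_length.trans_le hu.1) R).symm

theorem encode_eq (k : List.Vector Bool (C.keyLen κ)) : C.encode R κ k.toList m.toList =
    (PMF.uniformOfFintype (List.Vector Bool (C.encTime κ))).map fun e =>
      (((C.toFiniteCode hu m).enc k e).output (Finset.restrict _ R)).toList := by
  rw [encode, C.enc.dist_eq _ (C.enc_time_eq k.toList_length m.toList_length)]
  exact congrArg (PMF.map · _) <| funext fun e =>
    (B.output_runShort _ _ (e.toList_length.trans_le hu.2.1) R).symm

theorem toReal_decode (k : List.Vector Bool (C.keyLen κ)) (y : List.Vector Bool (C.codeLen κ)) :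
    (C.decode R κ k.toList y.toList (some m.toList)).toReal =
      acceptProb ((C.toFiniteCode hu m).dec k) (Finset.restrict _ R) y := by
  have output_eq (d : List.Vector Bool (C.decTime κ)) :
      (((C.toFiniteCode hu m).dec k d y).output (Finset.restrict _ R) = true) =
        (readMessage (C.dec.machine.result (B.fn R) ![unary κ, k.toList, y.toList] d.toList) =
          some m.toList) := by
    simp only [toFiniteCode, QueryAlgorithm.map, CryptoOracle.output_runShort, decide_eq_true_eq]
  simp only [acceptProb, output_eq]
  rw [decode, C.dec.dist_eq _ (C.dec_time_eq k.toList_length y.toList_length), PMF.map_comp,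
    toReal_map_uniform]
  rfl

end Games

theorem prob_completenessGame (ρ : ℕ → unitInterval) :
    prob (C.completenessGame ρ κ m.toList) {some m.toList} =
      (C.toFiniteCode hu m).completeness (ρ κ) := by
  rw [FiniteCode.completeness, Finset.expect_comm]
  refine prob_eq_expect fun R => ?_
  change ((PMF.bind _ fun sk => PMF.bind _ fun c => PMF.bind _ fun c' => _) _).toReal = _
  rw [C.sampleKey_eq hu m, toReal_map_uniform_bind]
  refine Finset.expect_congr rfl fun r _ => ?_
  rw [C.encode_eq hu m, toReal_map_uniform_bind]
  refine Finset.expect_congr rfl fun e _ => ?_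
  rw [toReal_noise_bind]
  simp only [C.toReal_decode hu m]

theorem prob_soundnessGame (y : List.Vector Bool (C.codeLen κ)) :
    prob (C.soundnessGame κ y.toList) {some m.toList} =
      (C.toFiniteCode hu m).falseAcceptance y := by
  rw [FiniteCode.falseAcceptance, Finset.expect_comm]
  refine prob_eq_expect fun R => ?_
  change ((PMF.bind _ fun sk => _) _).toReal = _
  rw [C.sampleKey_eq hu m, toReal_map_uniform_bind]
  exact Finset.expect_congr rfl fun r _ => C.toReal_decode hu m R _ y

theorem falseAcceptance_le {μ : ℕ → ℝ} (hμ : C.Sound μ) (y : List.Vector Bool (C.codeLen κ)) :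
    (C.toFiniteCode hu m).falseAcceptance y ≤ μ κ := by
  rw [← C.prob_soundnessGame hu m]
  linarith [hμ κ y, prob_add_prob_le_one (C.soundnessGame κ y.toList)
    (Option.some_ne_none m.toList)]

end OracleCode

/-! ### The attack -/

theorem uniformProb_fin_succ {I : Type*} [Fintype I] {p : ℕ} (P : (Fin (p + 1) → I) → Prop) :
    uniformProb P = 𝔼 i₀, uniformProb fun i : Fin p → I => P (Fin.cons i₀ i) := by
  classical
  rw [← uniformProb_prod fun x : I × (Fin p → I) => P (Fin.cons x.1 x.2)]
  simp only [uniformProb_eq_expect]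
  exact (Fintype.expect_equiv (Fin.consEquiv fun _ => I) _ _ fun _ => rfl).symm

namespace Adversary

variable {k n : ℕ} (m : List.Vector Bool k)

open Classical in
/-- The adversary that asks for `p` encodings of `m` and guesses whether they satisfy `P`. -/
noncomputable def sampleAndTest : (p : ℕ) → ((Fin p → List.Vector Bool n) → Prop) → Adversary k
  | 0, P => .guess (decide (P Fin.elim0))
  | p + 1, P => .askEnc m fun c =>
      if h : c.length = n then sampleAndTest p fun v => P (Fin.cons ⟨c, h⟩ v) else .guess false

theorem costAtMost_sampleAndTest : ∀ (p : ℕ) (P : (Fin p → List.Vector Bool n) → Prop),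
    (sampleAndTest m p P).CostAtMost p
  | 0, _ => trivial
  | p + 1, P => by
    refine ⟨Nat.le_add_left 1 p, fun c => ?_⟩
    beta_reduce
    split_ifs with h
    · exact costAtMost_sampleAndTest p _
    · trivial

theorem toReal_run_sampleAndTest {I : Type} [Fintype I] [Nonempty I] {s : I → List.Vector Bool n}
    {E : List Bool → PMF (List Bool)} (O : List Bool → List Bool)
    (hE : E m.toList = (PMF.uniformOfFintype I).map fun i => (s i).toList) :
    ∀ (p : ℕ) (P : (Fin p → List.Vector Bool n) → Prop),
      ((sampleAndTest m p P).run E O true).toReal =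
        uniformProb fun i : Fin p → I => P fun j => s (i j)
  | 0, P => by
    have event_eq : (fun i : Fin 0 → I => P fun j => s (i j)) = fun _ => P Fin.elim0 :=
      funext fun _ => congrArg P (Subsingleton.elim _ _)
    rw [event_eq]
    simp only [sampleAndTest, run, PMF.pure_apply, uniformProb, Fintype.expect_const]
    by_cases hP : P Fin.elim0 <;> simp [hP]
  | p + 1, P => by
    have cons_eq (i₀ : I) (i : Fin p → I) :
        (fun j => s ((Fin.cons i₀ i : Fin (p + 1) → I) j)) =
          (Fin.cons (s i₀) fun j => s (i j) : Fin (p + 1) → List.Vector Bool n) :=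
      funext fun j => by refine Fin.cases ?_ (fun _ => ?_) j <;> rfl
    simp only [sampleAndTest, run, hE]
    rw [toReal_map_uniform_bind, uniformProb_fin_succ]
    refine Finset.expect_congr rfl fun i₀ _ => ?_
    simp only [cons_eq]
    rw [dif_pos (s i₀).toList_length]
    exact toReal_run_sampleAndTest O hE p _

end Adversary

section Parameters

variable {R : Type*} [CommSemiring R]

/-- A bound on the number of queries of the algorithms of a code, when their running times are at
most `u` and the queried strings have length at most `L`.  The `1` makes it positive. -/
def queryBound (u L : R) : R := u * L + 1

/-- The logarithm of a bound on the number of keys and tables, with `u` and `L` as in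
`queryBound`. -/
def logTableCount (u L G : R) (m : ℕ) : R :=
  u + 1 + (L + 3) * tableSize (queryBound u L) G m

/-- The number of encodings that the attack asks for. -/
def attackCost (u L G : R) (m : ℕ) : R :=
  sampleSize (invAdvantage (queryBound u L) G) (logTableCount u L G m)

/-- The inverse of the advantage of the attack. -/
def attackInvAdvantage (u L G : R) : R := invAdvantage (queryBound u L) G

theorem eval_attackCost (u L G : Polynomial ℕ) (m κ : ℕ) :
    (attackCost u L G m).eval κ = attackCost (u.eval κ) (L.eval κ) (G.eval κ) m := by
  simp only [attackCost, sampleSize, logTableCount, tableSize, invAdvantage, statisticBound, invEps,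
    queryBound, Polynomial.eval_add, Polynomial.eval_mul, Polynomial.eval_pow,
    Polynomial.eval_one, Polynomial.eval_ofNat]

theorem eval_attackInvAdvantage (u L G : Polynomial ℕ) (κ : ℕ) :
    (attackInvAdvantage u L G).eval κ =
      attackInvAdvantage (u.eval κ) (L.eval κ) (G.eval κ) := by
  simp only [attackInvAdvantage, invAdvantage, statisticBound, invEps, queryBound,
    Polynomial.eval_add, Polynomial.eval_mul, Polynomial.eval_one, Polynomial.eval_ofNat]

theorem attackInvAdvantage_pos (u L : ℕ) {G : ℕ} (hG : 0 < G) : 0 < attackInvAdvantage u L G := by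
  simp only [attackInvAdvantage, invAdvantage, statisticBound]
  positivity

end Parameters

namespace OracleCode

variable {B : CryptoOracle} (C : OracleCode B) {κ u : ℕ}

section Games

variable (m : List.Vector Bool (C.msgLen κ)) {p : ℕ}
  (P : (Fin p → List.Vector Bool (C.codeLen κ)) → Prop)

theorem prob_realGame_sampleAndTest (hu : C.TimeAtMost κ u) :
    prob (C.realGame κ (Adversary.sampleAndTest m p P)) {true} =
      𝔼 r, 𝔼 ω, uniformProb fun e : Fin p → List.Vector Bool (C.encTime κ) => P fun j =>
        ((C.toFiniteCode hu m).enc (((C.toFiniteCode hu m).key r).output ω) (e j)).output ω := by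
  rw [Finset.expect_comm]
  refine prob_eq_expect fun R => ?_
  change ((PMF.bind _ fun sk => _) _).toReal = _
  rw [C.sampleKey_eq hu m, toReal_map_uniform_bind]
  exact Finset.expect_congr rfl fun r _ =>
    Adversary.toReal_run_sampleAndTest m _ (C.encode_eq hu m R _) p P

theorem prob_idealGame_sampleAndTest :
    prob (C.idealGame κ (Adversary.sampleAndTest m p P)) {true} = uniformProb P :=
  (prob_eq_expect (s := ∅) (G := fun _ => uniformProb P) fun _ =>
    Adversary.toReal_run_sampleAndTest (s := id) m _ rfl p P).trans (Fintype.expect_const _)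

end Games

theorem card_keys_mul_tables_le {T : ℕ} :
    Fintype.card (List.Vector Bool (C.keyLen κ) ×
      (Fin T → Option (shortStrings (B.alg.time.eval u) × Bool))) ≤
      2 ^ (C.keyLen κ + (B.alg.time.eval u + 3) * T) := by
  have card_entry : 2 ^ (B.alg.time.eval u + 1) * 2 + 1 ≤ 2 ^ (B.alg.time.eval u + 3) := by
    have := Nat.one_le_two_pow (n := B.alg.time.eval u + 1)
    rw [pow_add _ _ 3, pow_add] at *
    omega
  rw [pow_add, pow_mul]
  simp only [Fintype.card_prod, card_vector, Fintype.card_bool, Fintype.card_fun,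
    Fintype.card_option, Fintype.card_coe, Fintype.card_fin]
  gcongr
  exact (by gcongr; exact card_shortStrings_le _ : _ ≤ _).trans card_entry

theorem exists_adversary_of_gap {ρ : ℕ → unitInterval} {δ μ : ℕ → ℝ} (hδ : C.Complete ρ δ)
    (hμ : C.Sound μ) (hu : C.TimeAtMost κ u) {m : ℕ} (hsse : SmallSetExpansion (ρ κ : ℝ) m)
    (hm : m ≠ 0) {G : ℕ} (hG : 0 < G) (hgap : 1 / (G : ℝ) ≤ 1 - δ κ - μ κ) :
    ∃ A : Adversary (C.msgLen κ), A.CostAtMost (attackCost u (B.alg.time.eval u) G m) ∧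
      1 / (attackInvAdvantage u (B.alg.time.eval u) G : ℕ) ≤
        |prob (C.realGame κ A) {true} - prob (C.idealGame κ A) {true}| := by
  let message : List.Vector Bool (C.msgLen κ) := List.Vector.replicate _ false
  let S := C.toFiniteCode hu message
  have card_le : Fintype.card (List.Vector Bool (C.keyLen κ) ×
      (Fin (tableSize S.maxQueries G m) → Option (shortStrings (B.alg.time.eval u) × Bool))) ≤
        2 ^ logTableCount u (B.alg.time.eval u) G m :=
    C.card_keys_mul_tables_le.trans <| Nat.pow_le_pow_right two_pos <|
      Nat.add_le_add_right (C.keyLen_le.trans (Nat.succ_le_succ hu.1)) _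
  have gap_le : 1 / (G : ℝ) ≤ S.completeness (ρ κ) - 𝔼 y, S.falseAcceptance y := by
    have complete := hδ κ message
    rw [C.prob_completenessGame hu] at complete
    have sound : 𝔼 y, S.falseAcceptance y ≤ μ κ :=
      Finset.expect_le Finset.univ_nonempty fun y _ => C.falseAcceptance_le hu message hμ y
    linarith
  obtain ⟨P, hP⟩ := S.exists_distinguisher (ρ κ).2.1 (ρ κ).2.2 hsse hm hG
    (Nat.succ_pos _) card_le gap_le
  refine ⟨Adversary.sampleAndTest message _ P, Adversary.costAtMost_sampleAndTest _ _ _, ?_⟩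
  rw [C.prob_realGame_sampleAndTest _ _ hu, C.prob_idealGame_sampleAndTest]
  exact hP.trans (le_abs_self _)

end OracleCode

/-! ### Asymptotics -/

theorem Negligible.eventually_lt_one_div_eval {f : ℕ → ℝ} (hf : Negligible f) {Q : Polynomial ℕ}
    (hQ : ∀ κ, 0 < Q.eval κ) : ∀ᶠ κ in atTop, f κ < 1 / (Q.eval κ : ℕ) := by
  have h := hf.polynomial_mul (Q.map (Nat.castRingHom ℝ)) 0
  simp only [pow_zero, one_mul, Polynomial.eval_natCast_map, eq_natCast] at h
  filter_upwards [h.eventually (gt_mem_nhds one_pos)] with κ hκ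
  rwa [lt_div_iff₀ (Nat.cast_pos.2 (hQ κ)), mul_comm]

theorem negligible_of_eventually_le {f : ℕ → ℝ} (h0 : 0 ≤ f)
    (h : ∀ c : ℕ, ∀ᶠ κ : ℕ in atTop, f κ ≤ 1 / (κ + 1 : ℝ) ^ c) : Negligible f := by
  intro c
  refine squeeze_zero' (.of_forall fun κ => mul_nonneg (by positivity) (h0 κ)) ?_
    tendsto_one_div_add_atTop_nhds_zero_nat
  filter_upwards [h (c + 1)] with κ hκ
  calc (κ : ℝ) ^ c * f κ ≤ (κ + 1 : ℝ) ^ c * (1 / (κ + 1 : ℝ) ^ (c + 1)) := by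
        gcongr
        · exact h0 κ
        · linarith
    _ = 1 / (κ + 1 : ℝ) := by
        field_simp
        ring

theorem ConstantRate.exists_smallSetExpansion {ρ : ℕ → unitInterval} (hρ : ConstantRate ρ) :
    ∃ m, m ≠ 0 ∧ ∀ᶠ κ in atTop, SmallSetExpansion (ρ κ : ℝ) m := by
  obtain ⟨c, hc, hρ⟩ := hρ
  obtain ⟨m, hm, hsse⟩ := _root_.exists_smallSetExpansion hc
  exact ⟨m, hm, hρ.mono fun κ hκ => hsse _ (ρ κ).2.1 hκ⟩

theorem OracleCode.StatPseudorandom.eventually_gap_lt {B : CryptoOracle} {C : OracleCode B}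
    (hC : C.StatPseudorandom) {ρ : ℕ → unitInterval} (hρ : ConstantRate ρ) {δ μ : ℕ → ℝ}
    (hδ : C.Complete ρ δ) (hμ : C.Sound μ) {G : Polynomial ℕ} (hG : ∀ κ, 0 < G.eval κ) :
    ∀ᶠ κ in atTop, 1 - δ κ - μ κ < 1 / (G.eval κ : ℕ) := by
  obtain ⟨U, hU⟩ := C.exists_timeAtMost_eval
  obtain ⟨m, hm, hsse⟩ := hρ.exists_smallSetExpansion
  let L : Polynomial ℕ := B.alg.time.comp U
  have eval_L (κ : ℕ) : L.eval κ = B.alg.time.eval (U.eval κ) := Polynomial.eval_comp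
  have exists_adversary (κ : ℕ) : ∃ A : Adversary (C.msgLen κ),
      A.CostAtMost ((attackCost U L G m).eval κ) ∧ (SmallSetExpansion (ρ κ : ℝ) m →
        1 / (G.eval κ : ℕ) ≤ 1 - δ κ - μ κ → 1 / ((attackInvAdvantage U L G).eval κ : ℕ) ≤
          |prob (C.realGame κ A) {true} - prob (C.idealGame κ A) {true}|) := by
    rw [eval_attackCost, eval_attackInvAdvantage, eval_L]
    by_cases h : SmallSetExpansion (ρ κ : ℝ) m ∧ 1 / (G.eval κ : ℕ) ≤ 1 - δ κ - μ κ
    · obtain ⟨A, cost, adv⟩ := C.exists_adversary_of_gap hδ hμ (hU κ) h.1 hm (hG κ) h.2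
      exact ⟨A, cost, fun _ _ => adv⟩
    · exact ⟨.guess false, trivial, fun h₁ h₂ => absurd ⟨h₁, h₂⟩ h⟩
  choose A cost adv using exists_adversary
  have negligible_advantage := hC A ⟨_, cost⟩
  have advantage_lt := negligible_advantage.eventually_lt_one_div_eval
    (Q := attackInvAdvantage U L G) fun κ => by
      rw [eval_attackInvAdvantage]
      exact attackInvAdvantage_pos _ _ (hG κ)
  filter_upwards [hsse, advantage_lt] with κ hsse advantage_lt
  exact lt_of_not_ge fun gap => (adv κ hsse gap).not_gt advantage_lt

theorem OracleCode.StatPseudorandom.negligible_gap {B : CryptoOracle} {C : OracleCode B}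
    (hC : C.StatPseudorandom) {ρ : ℕ → unitInterval} (hρ : ConstantRate ρ) {δ μ : ℕ → ℝ}
    (hδ : C.Complete ρ δ) (hμ : C.Sound μ) : Negligible fun κ => max 0 (1 - δ κ - μ κ) := by
  refine negligible_of_eventually_le (fun κ => le_max_left _ _) fun c => ?_
  filter_upwards [hC.eventually_gap_lt hρ hδ hμ (G := (.X + 1) ^ c) (by simp)] with κ gap_lt
  refine max_le (by positivity) (gap_lt.le.trans_eq (by simp))

theorem mainTheorem2 (B : CryptoOracle) (ρ : ℕ → unitInterval) (hρ : ConstantRate ρ) :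
    (¬ ∃ C : OracleCode B, C.IsStatPRC ρ) ∧
    ∀ (C : OracleCode B) (δ μ : ℕ → ℝ),
      C.StatPseudorandom → C.Complete ρ δ → C.Sound μ →
        ∃ ν : ℕ → ℝ, Negligible ν ∧ ∀ κ, 1 - ν κ ≤ δ κ + μ κ := by
  constructor
  · rintro ⟨C, hC, ⟨δ, hδ, complete⟩, μ, hμ, sound⟩
    have gap_lt := hC.eventually_gap_lt hρ complete sound (G := 2) (by simp)
    have error_lt := Negligible.eventually_lt_one_div_eval (f := δ + μ) (hδ.add hμ) (Q := 2)
      (by simp)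
    obtain ⟨κ, gap_lt, error_lt⟩ := (gap_lt.and error_lt).exists
    norm_num at gap_lt error_lt
    linarith
  · intro C δ μ hC complete sound
    refine ⟨_, hC.negligible_gap hρ complete sound, fun κ => ?_⟩
    linarith [le_max_right 0 (1 - δ κ - μ κ)]
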